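/- Let $d\ge 1$ and let $(X,Y),(X_1,Y_1),(X_2,Y_2),\dots$ be i.i.d. random pairs with values in $\mathbb R^d\times\{0,1\}$. Let $\mu$ be the law of $X$, let $\eta(x)=\mathbb E(Y\mid X=x)$ be (a version of) the conditional mean and $v(x)=\operatorname{var}(Y\mid X=x)$ (a version of) the conditional variance function. Assume that * $\mu$ is the uniform distribution on a compact convex subset of $\mathbb R^d$ with non-empty interior, and its support $\operatorname{supp}(\mu)$ is a simple polytope (a polytope each of whose vertices lies on exactly as many edges as its dimension); * there are real constants $A,A'$ and $\alpha,\alpha'>0$ such that $|\eta(x)-\eta(x')|\le A\|x-x'\|^{\alpha}$ and $|v(x)-v(x')|\le A'\|x-x'\|^{\alpha'}$ for all $x,x'\in\operatorname{supp}(\mu)$. Let $T$ be any Delaunay triangulation scheme: to every finite family of points $x_1,\dots,x_n$ that affinely spans $\mathbb R^d$ it assigns a triangulation of $\operatorname{conv}(x_1,\dots,x_n)$ into non-degenerate $d$-simplices with vertices among the $x_i$, any two of which intersect exactly in their common face, and such that the open ball bounded by the circumsphere of each simplex contains none of the $x_i$. Let $\hat\eta=\hat\eta_n$ be the simplicial interpolation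 of $(X_1,Y_1),\dots,(X_n,Y_n)$: on each simplex of the triangulation of $X_1,\dots,X_n$ it is the affine function which takes the values $Y_i$ at the vertices $X_i$ of this simplex, and $\hat\eta(x)=1/2$ for $x\notin\operatorname{conv}(X_1,\dots,X_n)$. Let $\hat f(x)=\mathbf 1\{\hat\eta(x)>1/2\}$ be the plug-in classifier and $f^*(x)=\mathbf 1\{\eta(x)>1/2\}$ the Bayes classifier. For a classifier $f$ let $R(f)=\mathbb P(f(X)\ne Y)$; thus $R(\hat f)$ is the conditional risk of $\hat f$ given the training data. Then $R(\hat f)-R(f^*)$ is an integrable random variable for every $n>d$, and $$\limsup_{n\to\infty}\ \mathbb E\big[R(\hat f)-R(f^*)\big]\ \le\ \sqrt{\frac{8}{d+2}\,\mathbb E\big[(Y-\eta(X))^2\big]}\,.$$ -/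

import Mathlib

open MeasureTheory ProbabilityTheory Filter

noncomputable section

namespace SimplicialRisk

/-- `Pt d` is `ℝ^d` with the Euclidean norm. -/
abbrev Pt (d : ℕ) : Type := EuclideanSpace ℝ (Fin d)

/-- `(A, α)`-smoothness (Hölder) of `g` on the support of `μ`. -/
def IsSmoothOnSupport {d : ℕ} (μ : Measure (Pt d)) (g : Pt d → ℝ) (A α : ℝ) : Prop :=
  ∀ x ∈ μ.support, ∀ x' ∈ μ.support, |g x - g x'| ≤ A * ‖x - x'‖ ^ α

/-- A simple polytope: the convex hull of a finite set, each of whose vertices lies on exactly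
as many edges (one-dimensional faces) as the dimension of the polytope. -/
def IsSimplePolytope {d : ℕ} (C : Set (Pt d)) : Prop :=
  (∃ V : Finset (Pt d), C = convexHull ℝ (V : Set (Pt d))) ∧
    ∀ v ∈ C.extremePoints ℝ,
      {F : Set (Pt d) | IsExposed ℝ C F ∧ v ∈ F ∧
        Module.finrank ℝ (vectorSpan ℝ F) = 1}.ncard = Module.finrank ℝ (vectorSpan ℝ C)

/-- The convex hull of the points `x i`, `i ∈ s`. -/
def hull {d n : ℕ} (x : Fin n → Pt d) (s : Finset (Fin n)) : Set (Pt d) :=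
  convexHull ℝ (x '' (s : Set (Fin n)))

/-- `T`, a finite collection of index sets, is a triangulation of the convex hull of the points
`x 0, …, x (n - 1)` into non-degenerate simplices with vertices at these points; any two of the
simplices intersect exactly in their common face. -/
structure IsTriangulation {d n : ℕ} (x : Fin n → Pt d) (T : Finset (Finset (Fin n))) : Prop where
  card_eq : ∀ s ∈ T, s.card = d + 1
  nondegenerate : ∀ s ∈ T, AffineIndependent ℝ (fun i : s => x i)
  cover : (⋃ s ∈ T, hull x s) = convexHull ℝ (Set.range x)
  inter_face : ∀ s ∈ T, ∀ t ∈ T, hull x s ∩ hull x t = hull x (s ∩ t)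

/-- A Delaunay triangulation: a triangulation such that the open ball bounded by the circumsphere
of any of its simplices contains none of the points. -/
structure IsDelaunay {d n : ℕ} (x : Fin n → Pt d) (T : Finset (Finset (Fin n))) : Prop
    extends IsTriangulation x T where
  empty_ball : ∀ s ∈ T, ∃ (c : Pt d) (r : ℝ),
    (∀ i ∈ s, dist (x i) c = r) ∧ ∀ j, r ≤ dist (x j) c

/-- A Delaunay triangulation scheme: a rule which assigns a Delaunay triangulation to every finite
family of points that spans `ℝ^d`. -/
def IsDelaunayScheme {d : ℕ} (T : (n : ℕ) → (Fin n → Pt d) → Finset (Finset (Fin n))) : Prop :=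
  ∀ (n : ℕ) (x : Fin n → Pt d), affineSpan ℝ (Set.range x) = ⊤ → IsDelaunay x (T n x)

open Classical in
/-- The linear (affine) interpolation of `(x i, y i)`, `i ∈ s`, evaluated at `z`: the value
`β₀ + ⟨z, β⟩`, where `(β₀, β)` solves `β₀ + ⟨x i, β⟩ = y i` for `i ∈ s`. The solution exists and is
unique when the `x i`, `i ∈ s`, are the `d + 1` vertices of a non-degenerate simplex, which is the
only case in which this is used. -/
def linearInterp {d n : ℕ} (s : Finset (Fin n)) (x : Fin n → Pt d) (y : Fin n → ℝ)
    (z : Pt d) : ℝ :=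
  if h : ∃ β : ℝ × Pt d, ∀ i ∈ s, β.1 + inner ℝ (x i) β.2 = y i then
    h.choose.1 + inner ℝ z h.choose.2
  else 0

open Classical in
/-- Simplicial interpolation of the data `(x i, y i)` with respect to the triangulation `T`: at a
point of a simplex of `T` it is the linear interpolation on this simplex (any of them, if there
are several); at a point in no simplex, it is `1 / 2`. -/
def simplicialInterp {d n : ℕ} (T : Finset (Finset (Fin n))) (x : Fin n → Pt d)
    (y : Fin n → ℝ) (z : Pt d) : ℝ :=
  if h : ∃ s ∈ T, z ∈ hull x s then linearInterp h.choose x y z else 1 / 2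

open Classical in
/-- The plug-in classifier `z ↦ 1{g z > 1/2}`. -/
def plugIn {d : ℕ} (g : Pt d → ℝ) (z : Pt d) : ℝ :=
  if 1 / 2 < g z then 1 else 0

/-- The risk `P(f(X) ≠ Y)` of a classifier `f` under zero-one loss. -/
def risk {Ω : Type*} [MeasurableSpace Ω] (P : Measure Ω) {d : ℕ} (X : Ω → Pt d) (Y : Ω → ℝ)
    (f : Pt d → ℝ) : ℝ :=
  P.real {ω | f (X ω) ≠ Y ω}

/-- The plug-in classifier based on simplicial interpolation of the training examples
`(X 1, Y 1), …, (X n, Y n)`, at the outcome `ω`. -/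
def simplicialClassifier {Ω : Type*} {d : ℕ}
    (T : (n : ℕ) → (Fin n → Pt d) → Finset (Finset (Fin n)))
    (X : ℕ → Ω → Pt d) (Y : ℕ → Ω → ℝ) (n : ℕ) (ω : Ω) : Pt d → ℝ :=
  plugIn (simplicialInterp (T n fun i => X (i + 1) ω) (fun i => X (i + 1) ω)
    (fun i => Y (i + 1) ω))

end SimplicialRisk

end

/-! ### Barycentric coordinates and interpolation on one simplex. -/

noncomputable section

open scoped Topology ENNReal

namespace SimplicialRisk

variable {d : ℕ}

/-! Let `g` be a continuous version of the regression function with values in `[0, 1]`. A plug-in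
classifier does worse than the Bayes classifier only where `1/2` separates its estimate from `g`, so
the expected excess risk is at most twice the mean absolute error of the estimate, hence at most
twice the root of its mean squared error (`IsRegression.integral_excess_le`).

On a simplex with vertices `p k` the estimate at `z` is the average of the labels with the
barycentric coordinates of `z` as weights. Given the points, the mean squared error is `∑ k, bary p
z k ^ 2 * bernoulliVar g (p k)` plus the squared error of interpolating `g` itself. On a simplex of
small diameter `g` is nearly constant: the second term is negligible and the variances are nearly
equal. What remains is the mean of `∑ k, bary p z k ^ 2` for `z` uniform on the simplex, which is `2
/ (d + 2)` for every shape (`setIntegral_sum_bary_sq`). So the mean squared error is asymptotically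
at most `2 / (d + 2)` times the noise variance (`IsRegression.mse_le`), and doubling its root gives
the constant `8 / (d + 2)`.

A triangulation scheme need not depend measurably on the points. Lifting the points to the
paraboloid `‖·‖ ^ 2` turns emptiness of a circumscribed ball into an affine inequality and yields a
measurable predicate `Cell` that does not mention the scheme. Almost surely the points are in
general position; then at most one cell contains `z` (`GenPos.cell_unique`), and every Delaunay
scheme interpolates as `interp` does at almost every `z` (`IsDelaunay.simplicialInterp_eq`).

A cell around `z` is small as soon as the points are dense near `z` (`DenseNear.dist_vertex_le`),
and for `z` in the interior of `C` this holds with probability tending to one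
(`IsDelaunayScheme.tendsto_badSet`). -/

/-- The homogeneous coordinates `(1, z)` of a point `z`. -/
def homog (z : Pt d) : Fin (d + 1) → ℝ := Fin.cons 1 fun i => z i

/-- The matrix whose rows are the homogeneous coordinates of the points `p k`. -/
def vertexMatrix (p : Fin (d + 1) → Pt d) : Matrix (Fin (d + 1)) (Fin (d + 1)) ℝ :=
  Matrix.of fun k => homog (p k)

/-- The barycentric coordinates of `z` with respect to the points `p k`. -/
def bary (p : Fin (d + 1) → Pt d) (z : Pt d) : Fin (d + 1) → ℝ :=
  Matrix.vecMul (homog z) (vertexMatrix p)⁻¹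

lemma vecMul_vertexMatrix_zero (p : Fin (d + 1) → Pt d) (c : Fin (d + 1) → ℝ) :
    Matrix.vecMul c (vertexMatrix p) 0 = ∑ k, c k := by
  simp [Matrix.vecMul, dotProduct, vertexMatrix, homog]

lemma vecMul_vertexMatrix_succ (p : Fin (d + 1) → Pt d) (c : Fin (d + 1) → ℝ) (i : Fin d) :
    Matrix.vecMul c (vertexMatrix p) i.succ = (∑ k, c k • p k) i := by
  simp [Matrix.vecMul, dotProduct, vertexMatrix, homog]

lemma vecMul_vertexMatrix_eq_homog_iff {p : Fin (d + 1) → Pt d} {c : Fin (d + 1) → ℝ}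
    {z : Pt d} :
    Matrix.vecMul c (vertexMatrix p) = homog z ↔ ∑ k, c k = 1 ∧ ∑ k, c k • p k = z := by
  constructor
  · intro h
    refine ⟨?_, ?_⟩
    · rw [← vecMul_vertexMatrix_zero p, h]; simp [homog]
    · ext i
      rw [← vecMul_vertexMatrix_succ p, h]; simp [homog]
  · rintro ⟨h1, h2⟩
    funext i
    refine Fin.cases ?_ (fun i => ?_) i
    · rw [vecMul_vertexMatrix_zero, h1]; simp [homog]
    · rw [vecMul_vertexMatrix_succ, h2]; simp [homog]

lemma bary_unique {p : Fin (d + 1) → Pt d} (hp : (vertexMatrix p).det ≠ 0)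
    {c : Fin (d + 1) → ℝ} {z : Pt d} (h1 : ∑ k, c k = 1) (h2 : ∑ k, c k • p k = z) :
    bary p z = c := by
  have hu : IsUnit (vertexMatrix p).det := isUnit_iff_ne_zero.2 hp
  rw [bary, ← vecMul_vertexMatrix_eq_homog_iff.2 ⟨h1, h2⟩, Matrix.vecMul_vecMul,
    Matrix.mul_nonsing_inv _ hu, Matrix.vecMul_one]

lemma bary_spec {p : Fin (d + 1) → Pt d} (hp : (vertexMatrix p).det ≠ 0) (z : Pt d) :
    ∑ k, bary p z k = 1 ∧ ∑ k, bary p z k • p k = z := by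
  have hu : IsUnit (vertexMatrix p).det := isUnit_iff_ne_zero.2 hp
  rw [← vecMul_vertexMatrix_eq_homog_iff, bary, Matrix.vecMul_vecMul,
    Matrix.nonsing_inv_mul _ hu, Matrix.vecMul_one]

lemma sum_bary {p : Fin (d + 1) → Pt d} (hp : (vertexMatrix p).det ≠ 0) (z : Pt d) :
    ∑ k, bary p z k = 1 := (bary_spec hp z).1

lemma sum_bary_smul {p : Fin (d + 1) → Pt d} (hp : (vertexMatrix p).det ≠ 0) (z : Pt d) :
    ∑ k, bary p z k • p k = z := (bary_spec hp z).2

lemma det_vertexMatrix_ne_zero_iff {p : Fin (d + 1) → Pt d} :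
    (vertexMatrix p).det ≠ 0 ↔ AffineIndependent ℝ p := by
  rw [affineIndependent_iff]
  constructor
  · intro hp s w h1 h2 k hk
    have h0 : Matrix.vecMul (fun k => if k ∈ s then w k else 0) (vertexMatrix p) = 0 := by
      funext i
      refine Fin.cases ?_ (fun i => ?_) i
      · rw [vecMul_vertexMatrix_zero]; simpa using h1
      · rw [vecMul_vertexMatrix_succ]; simp [ite_smul, h2]
    have := Matrix.eq_zero_of_vecMul_eq_zero hp h0
    simpa [hk] using congrFun this k
  · intro h hdet
    obtain ⟨c, hc0, hc⟩ := Matrix.exists_vecMul_eq_zero_iff.2 hdet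
    refine hc0 (funext fun k => h Finset.univ c ?_ ?_ k (Finset.mem_univ k))
    · rw [← vecMul_vertexMatrix_zero p, hc]; rfl
    · ext i
      rw [← vecMul_vertexMatrix_succ p, hc]; rfl

lemma measurable_homog : Measurable (homog (d := d)) := by
  refine measurable_pi_iff.2 fun i => Fin.cases ?_ (fun i => ?_) i
  · simp [homog]
  · simp only [homog, Fin.cons_succ]; fun_prop

lemma measurable_det_vertexMatrix :
    Measurable fun p : Fin (d + 1) → Pt d => (vertexMatrix p).det := by
  simp only [Matrix.det_apply]
  refine Finset.measurable_sum _ fun σ _ => ?_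
  refine Measurable.const_smul (Finset.measurable_prod _ fun k _ => ?_) _
  exact (measurable_pi_apply k).comp (measurable_homog.comp (measurable_pi_apply (σ k)))

/-- By Cramer's rule a coordinate is a quotient of polynomials in `p` and `z`. Degenerate `p` need
no separate case, as inversion on `ℝ` with `0⁻¹ = 0` is measurable. -/
lemma measurable_bary (k : Fin (d + 1)) :
    Measurable fun q : (Fin (d + 1) → Pt d) × Pt d => bary q.1 q.2 k := by
  have hM : ∀ i j, Measurable fun p : Fin (d + 1) → Pt d => vertexMatrix p i j := fun i j =>
    (measurable_pi_apply j).comp (measurable_homog.comp (measurable_pi_apply i))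
  simp only [bary, Matrix.vecMul, dotProduct, Matrix.inv_def, Matrix.smul_apply, Ring.inverse_eq_inv',
    Matrix.adjugate_apply, smul_eq_mul]
  refine Finset.measurable_sum _ fun i _ => ?_
  refine ((measurable_pi_apply i).comp (measurable_homog.comp measurable_snd)).mul ?_
  refine ((measurable_det_vertexMatrix.comp measurable_fst).inv).mul ?_
  simp only [Matrix.det_apply]
  refine Finset.measurable_sum _ fun σ _ => ?_
  refine Measurable.const_smul (Finset.measurable_prod _ fun j _ => ?_) _
  by_cases h : σ j = k
  · simp [Matrix.updateRow_apply, h]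
  · simp only [Matrix.updateRow_apply, h, if_false]
    exact (hM (σ j) j).comp measurable_fst

lemma linear_comb_bary_affine {p : Fin (d + 1) → Pt d} (hp : (vertexMatrix p).det ≠ 0)
    (a : ℝ) (b z : Pt d) : ∑ k, bary p z k * (a + inner ℝ (p k) b) = a + inner ℝ z b := by
  simp only [mul_add, Finset.sum_add_distrib, ← Finset.sum_mul, sum_bary hp, one_mul]
  congr 1
  conv_rhs => rw [← sum_bary_smul hp z, sum_inner]
  simp [inner_smul_left]

/-- Any affine interpolation problem at the vertices of a non-degenerate simplex is solvable. -/
lemma exists_affine_interp {p : Fin (d + 1) → Pt d} (hp : (vertexMatrix p).det ≠ 0)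
    (y : Fin (d + 1) → ℝ) : ∃ β : ℝ × Pt d, ∀ k, β.1 + inner ℝ (p k) β.2 = y k := by
  have hu : IsUnit (vertexMatrix p).det := isUnit_iff_ne_zero.2 hp
  set c := Matrix.mulVec (vertexMatrix p)⁻¹ y with hc
  have h : Matrix.mulVec (vertexMatrix p) c = y := by
    rw [hc, Matrix.mulVec_mulVec, Matrix.mul_nonsing_inv _ hu, Matrix.one_mulVec]
  refine ⟨(c 0, WithLp.toLp 2 fun i => c i.succ), fun k => ?_⟩
  have := congrFun h k
  rw [← this]
  simp [Matrix.mulVec, dotProduct, vertexMatrix, homog, Fin.sum_univ_succ, PiLp.inner_apply,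
    mul_comm]

/-- The sets of `d + 1` indices. -/
abbrev Idx (d n : ℕ) : Type := {s : Finset (Fin n) // s.card = d + 1}

/-- The increasing enumeration of the elements of `s`. -/
def enum {n : ℕ} (s : Idx d n) : Fin (d + 1) → Fin n := s.1.orderEmbOfFin s.2

lemma enum_injective {n : ℕ} (s : Idx d n) : Function.Injective (enum s) :=
  (s.1.orderEmbOfFin s.2).injective

lemma range_enum {n : ℕ} (s : Idx d n) : Set.range (enum s) = s.1 :=
  Finset.range_orderEmbOfFin _ _

lemma enum_mem {n : ℕ} (s : Idx d n) (k : Fin (d + 1)) : enum s k ∈ s.1 :=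
  Finset.orderEmbOfFin_mem _ _ _

lemma exists_enum_eq {n : ℕ} (s : Idx d n) {i : Fin n} (hi : i ∈ s.1) : ∃ k, enum s k = i := by
  have : i ∈ Set.range (enum s) := by rw [range_enum]; exact hi
  exact this

/-- The vertices of the simplex with index set `s`. -/
def verts {n : ℕ} (x : Fin n → Pt d) (s : Idx d n) : Fin (d + 1) → Pt d := fun k => x (enum s k)

lemma hull_eq {n : ℕ} (x : Fin n → Pt d) (s : Idx d n) :
    hull x s.1 = convexHull ℝ (Set.range (verts x s)) := by
  rw [hull, ← range_enum, ← Set.range_comp]; rfl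

lemma mem_hull_iff {n : ℕ} {x : Fin n → Pt d} {s : Idx d n}
    (h : (vertexMatrix (verts x s)).det ≠ 0) (z : Pt d) :
    z ∈ hull x s.1 ↔ ∀ k, 0 ≤ bary (verts x s) z k := by
  rw [hull_eq, convexHull_range_eq_exists_affineCombination]
  constructor
  · rintro ⟨t, w, hw0, hw1, rfl⟩ k
    rw [Finset.affineCombination_eq_linear_combination _ _ _ hw1]
    rw [bary_unique h (c := fun k => if k ∈ t then w k else 0)]
    · dsimp only; split_ifs with hk
      · exact hw0 k hk
      · exact le_rfl
    · simpa using hw1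
    · simp [ite_smul]
  · intro h0
    refine ⟨Finset.univ, bary (verts x s) z, fun k _ => h0 k, sum_bary h z, ?_⟩
    rw [Finset.affineCombination_eq_linear_combination _ _ _ (sum_bary h z), sum_bary_smul h]

lemma affineIndependent_subtype_iff {n : ℕ} {x : Fin n → Pt d} (s : Idx d n) :
    AffineIndependent ℝ (fun i : s.1 => x i) ↔ (vertexMatrix (verts x s)).det ≠ 0 := by
  rw [det_vertexMatrix_ne_zero_iff]
  exact (affineIndependent_equiv (p := fun i : s.1 => x i)
    (s.1.orderIsoOfFin s.2).toEquiv).symm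

lemma linearInterp_eq {n : ℕ} {x : Fin n → Pt d} {s : Idx d n}
    (h : (vertexMatrix (verts x s)).det ≠ 0) (y : Fin n → ℝ) (z : Pt d) :
    linearInterp s.1 x y z = ∑ k, bary (verts x s) z k * y (enum s k) := by
  have hex : ∃ β : ℝ × Pt d, ∀ i ∈ s.1, β.1 + inner ℝ (x i) β.2 = y i := by
    obtain ⟨β, hβ⟩ := exists_affine_interp h fun k => y (enum s k)
    refine ⟨β, fun i hi => ?_⟩
    obtain ⟨k, rfl⟩ := exists_enum_eq s hi
    exact hβ k
  rw [linearInterp, dif_pos hex, ← linear_comb_bary_affine h]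
  refine Finset.sum_congr rfl fun k _ => ?_
  rw [verts, hex.choose_spec _ (enum_mem s k)]

end SimplicialRisk

end

/-! ### Delaunay cells through the paraboloid lift; general position. -/

noncomputable section

open scoped Topology ENNReal

namespace SimplicialRisk

variable {d : ℕ}

/-- The affine function which agrees with `‖·‖²` at the points `p k`. -/
def lift (p : Fin (d + 1) → Pt d) (z : Pt d) : ℝ := ∑ k, bary p z k * ‖p k‖ ^ 2

/-- `z` lies in the interior of the non-degenerate simplex with index set `s`, and the open ball
bounded by the circumsphere of this simplex contains none of the points. -/
def Cell {n : ℕ} (x : Fin n → Pt d) (s : Idx d n) (z : Pt d) : Prop :=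
  (vertexMatrix (verts x s)).det ≠ 0 ∧ (∀ k, 0 < bary (verts x s) z k) ∧
    ∀ j, lift (verts x s) (x j) ≤ ‖x j‖ ^ 2

/-- No `d + 1` of the points lie on a hyperplane, and no `d + 2` on a sphere. -/
def GenPos {n : ℕ} (x : Fin n → Pt d) : Prop :=
  ∀ s : Idx d n, (vertexMatrix (verts x s)).det ≠ 0 ∧
    ∀ j ∉ s.1, lift (verts x s) (x j) ≠ ‖x j‖ ^ 2

lemma exists_lift_eq {p : Fin (d + 1) → Pt d} (hp : (vertexMatrix p).det ≠ 0) :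
    ∃ (a : ℝ) (b : Pt d), (∀ z, lift p z = a + inner ℝ z b) ∧
      ∀ k, a + inner ℝ (p k) b = ‖p k‖ ^ 2 := by
  obtain ⟨⟨a, b⟩, h⟩ := exists_affine_interp hp fun k => ‖p k‖ ^ 2
  refine ⟨a, b, fun z => ?_, h⟩
  rw [lift, ← linear_comb_bary_affine hp]
  exact Finset.sum_congr rfl fun k _ => by rw [← h k]

lemma lift_eq_sum_bary {p q : Fin (d + 1) → Pt d} (hp : (vertexMatrix p).det ≠ 0)
    (hq : (vertexMatrix q).det ≠ 0) (z : Pt d) : lift p z = ∑ k, bary q z k * lift p (q k) := by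
  obtain ⟨a, b, h1, -⟩ := exists_lift_eq hp
  simp only [h1, linear_comb_bary_affine hq]

/-- The lift of `s` is affine, so its value at `z` is the average of its values at the vertices of
`t`. There it is at most `‖·‖ ^ 2`, because the circumscribed ball of `s` is empty, and the average
of `‖·‖ ^ 2` is the lift of `t` at `z`. -/
lemma Cell.lift_le {n : ℕ} {x : Fin n → Pt d} {s t : Idx d n} {z : Pt d} (hs : Cell x s z)
    (ht : Cell x t z) : lift (verts x s) z ≤ lift (verts x t) z := by
  rw [lift_eq_sum_bary hs.1 ht.1]
  exact Finset.sum_le_sum fun k _ => mul_le_mul_of_nonneg_left (hs.2.2 _) (ht.2.1 k).le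

/-- By symmetry the two lifts agree at `z`. All weights of `z` are positive, so the lift of `s` must
meet the paraboloid at every vertex of `t`; in general position it meets it only at its own
vertices. -/
lemma GenPos.cell_unique {n : ℕ} {x : Fin n → Pt d} (hx : GenPos x) {s t : Idx d n} {z : Pt d}
    (hs : Cell x s z) (ht : Cell x t z) : s = t := by
  have heq : lift (verts x s) z = lift (verts x t) z := (hs.lift_le ht).antisymm (ht.lift_le hs)
  have hsub : t.1 ⊆ s.1 := by
    intro i hi
    obtain ⟨k, rfl⟩ := exists_enum_eq t hi
    by_contra hk
    have hlt : lift (verts x s) z < lift (verts x t) z := by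
      rw [lift_eq_sum_bary hs.1 ht.1]
      refine Finset.sum_lt_sum (fun k _ => mul_le_mul_of_nonneg_left (hs.2.2 _) (ht.2.1 k).le)
        ⟨k, Finset.mem_univ k, ?_⟩
      exact mul_lt_mul_of_pos_left (lt_of_le_of_ne (hs.2.2 _) ((hx s).2 _ hk)) (ht.2.1 k)
    exact hlt.ne heq
  exact Subtype.ext (Finset.eq_of_subset_of_card_le hsub (by rw [s.2, t.2])).symm

lemma measurable_verts {n : ℕ} (s : Idx d n) : Measurable fun x : Fin n → Pt d => verts x s :=
  measurable_pi_iff.2 fun k => measurable_pi_apply (enum s k)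

lemma measurable_lift : Measurable fun q : (Fin (d + 1) → Pt d) × Pt d => lift q.1 q.2 := by
  refine Finset.measurable_sum _ fun k _ => (measurable_bary k).mul ?_
  exact (((measurable_pi_apply k).comp measurable_fst).norm).pow_const 2

lemma measurable_det_verts {n : ℕ} (s : Idx d n) :
    Measurable fun x : Fin n → Pt d => (vertexMatrix (verts x s)).det :=
  measurable_det_vertexMatrix.comp (measurable_verts s)

lemma measurable_bary_verts {n : ℕ} (s : Idx d n) (k : Fin (d + 1)) :
    Measurable fun q : (Fin n → Pt d) × Pt d => bary (verts q.1 s) q.2 k :=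
  (measurable_bary k).comp (((measurable_verts s).comp measurable_fst).prodMk measurable_snd)

lemma measurable_lift_verts {n : ℕ} (s : Idx d n) (j : Fin n) :
    Measurable fun x : Fin n → Pt d => lift (verts x s) (x j) := by
  have h : Measurable fun x : Fin n → Pt d => (verts x s, x j) :=
    (measurable_verts s).prodMk (measurable_pi_apply j)
  have h2 : Measurable ((fun q : (Fin (d + 1) → Pt d) × Pt d => lift q.1 q.2) ∘
      fun x : Fin n → Pt d => (verts x s, x j)) := measurable_lift.comp h
  exact h2

lemma measurableSet_det_verts_ne_zero {n : ℕ} (s : Idx d n) :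
    MeasurableSet {x : Fin n → Pt d | (vertexMatrix (verts x s)).det ≠ 0} :=
  (measurableSet_singleton (0 : ℝ)).compl.preimage (measurable_det_verts s)

lemma measurableSet_cell {n : ℕ} (s : Idx d n) :
    MeasurableSet {q : (Fin n → Pt d) × Pt d | Cell q.1 s q.2} := by
  refine MeasurableSet.inter ((measurableSet_det_verts_ne_zero s).preimage measurable_fst)
    (MeasurableSet.inter ?_ ?_)
  · change MeasurableSet {q : (Fin n → Pt d) × Pt d | ∀ k, 0 < bary (verts q.1 s) q.2 k}
    rw [Set.ofPred_forall]
    exact MeasurableSet.iInter fun k => measurableSet_lt measurable_const (measurable_bary_verts s k)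
  · change MeasurableSet {q : (Fin n → Pt d) × Pt d | ∀ j, lift (verts q.1 s) (q.1 j) ≤ ‖q.1 j‖ ^ 2}
    rw [Set.ofPred_forall]
    refine MeasurableSet.iInter fun j => measurableSet_le
      ((measurable_lift_verts s j).comp measurable_fst) ?_
    exact (((measurable_pi_apply j).comp measurable_fst).norm).pow_const 2

lemma exists_det_vertexMatrix_ne_zero :
    ∃ q : Fin (d + 1) → Pt d, (vertexMatrix q).det ≠ 0 := by
  obtain ⟨b⟩ := AffineBasis.exists_affineBasis_of_finiteDimensional (k := ℝ) (P := Pt d)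
    (ι := Fin (d + 1)) (by simp)
  exact ⟨b, det_vertexMatrix_ne_zero_iff.2 b.ind⟩

lemma det_vertexMatrix_smul (t : ℝ) (p : Fin (d + 1) → Pt d) :
    (vertexMatrix (t • p)).det = (vertexMatrix p).det * t ^ d := by
  have : vertexMatrix (t • p) = vertexMatrix p * Matrix.diagonal (Fin.cons 1 fun _ => t) := by
    ext i j
    rw [Matrix.mul_diagonal]
    refine Fin.cases ?_ (fun j => ?_) j <;> simp [vertexMatrix, homog, mul_comm]
  rw [this, Matrix.det_mul, Matrix.det_diagonal, Fin.prod_univ_succ]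
  simp

-- The determinant is a polynomial in `u` whose constant coefficient is that of `q`, so it is not
-- the zero polynomial.
open Polynomial in
lemma finite_det_smul_add_eq_zero {q : Fin (d + 1) → Pt d} (hq : (vertexMatrix q).det ≠ 0)
    (p : Fin (d + 1) → Pt d) :
    {u : ℝ | (vertexMatrix (u • p + q)).det = 0}.Finite := by
  -- The first column is zero so that the homogenizing coordinate of `u • p + q` stays `1`.
  set A : Matrix (Fin (d + 1)) (Fin (d + 1)) ℝ := Matrix.of fun k => Fin.cons 0 fun i => p k i
  set f : ℝ[X] := ((X : ℝ[X]) • A.map C + (vertexMatrix q).map C).det with hf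
  have hf0 : f ≠ 0 := by
    intro h
    have := coeff_det_X_add_C_zero A (vertexMatrix q)
    rw [← hf, h] at this
    exact hq this.symm
  refine (f.rootSet_finite ℝ).subset fun u hu => ?_
  rw [mem_rootSet]
  refine ⟨hf0, ?_⟩
  rw [aeval_def, eval₂_eq_eval_map, Algebra.algebraMap_self, Polynomial.map_id, hf, ← coe_evalRingHom,
    RingHom.map_det]
  refine Eq.trans (congrArg Matrix.det ?_) hu
  ext i j
  refine Fin.cases ?_ (fun j => ?_) j
  · simp [vertexMatrix, homog, A, RingHom.mapMatrix_apply]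
  · simp [vertexMatrix, homog, A, RingHom.mapMatrix_apply]
    ring

/-- For `t ≠ 0` factor out `t` and use the finiteness in `u = t⁻¹`; the value `t = 0` is simply
added to the finite set. -/
lemma finite_det_add_smul_eq_zero {q : Fin (d + 1) → Pt d} (hq : (vertexMatrix q).det ≠ 0)
    (p : Fin (d + 1) → Pt d) :
    {t : ℝ | (vertexMatrix (p + t • q)).det = 0}.Finite := by
  refine (((finite_det_smul_add_eq_zero hq p).image (·⁻¹)).insert 0).subset fun t ht => ?_
  rcases eq_or_ne t 0 with rfl | h0
  · exact Set.mem_insert _ _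
  refine Set.mem_insert_of_mem _ ⟨t⁻¹, ?_, inv_inv t⟩
  have h : p + t • q = t • (t⁻¹ • p + q) := by rw [smul_add, smul_inv_smul₀ h0]
  have ht' : (vertexMatrix (p + t • q)).det = 0 := ht
  rw [h, det_vertexMatrix_smul] at ht'
  exact (mul_eq_zero.1 ht').resolve_right (pow_ne_zero _ h0)

/-- Fubini along parallel lines: in a direction whose `s`-part is a non-degenerate simplex, each
line meets the degenerate configurations finitely often. -/
lemma ae_det_verts_ne_zero {n : ℕ} (s : Idx d n) :
    ∀ᵐ x : Fin n → Pt d, (vertexMatrix (verts x s)).det ≠ 0 := by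
  obtain ⟨q, hq⟩ := exists_det_vertexMatrix_ne_zero (d := d)
  set q' : Fin n → Pt d := Function.extend (enum s) q 0 with hq'
  have hv : verts q' s = q := by
    funext k; exact (enum_injective s).extend_apply _ _ _
  refine ae_mem_of_ae_add_linearMap_mem (LinearMap.toSpanSingleton ℝ (Fin n → Pt d) q')
    (μ := volume) volume (measurableSet_det_verts_ne_zero s) fun y => ?_
  have hfin := finite_det_add_smul_eq_zero hq (verts y s)
  refine measure_mono_null (fun t ht => ?_) (hfin.measure_zero volume)
  rw [← hv]
  exact not_not.1 ht

lemma volume_sphere_like_eq_zero (hd : 1 ≤ d) (a : ℝ) (b y : Pt d) :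
    volume {u : Pt d | a + inner ℝ (y + u) b = ‖y + u‖ ^ 2} = 0 := by
  have : Nontrivial (Pt d) := by
    have : Nonempty (Fin d) := ⟨⟨0, hd⟩⟩
    infer_instance
  -- Completing the square shows that the set lies in a sphere about `b / 2 - y`.
  refine measure_mono_null (fun u hu => ?_)
    (Measure.addHaar_sphere volume ((2⁻¹ : ℝ) • b - y) (√(a + ‖b‖ ^ 2 / 4)))
  have hu' : a + inner ℝ (y + u) b = ‖y + u‖ ^ 2 := hu
  have h : ‖u - ((2⁻¹ : ℝ) • b - y)‖ ^ 2 = a + ‖b‖ ^ 2 / 4 := by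
    have : u - ((2⁻¹ : ℝ) • b - y) = (y + u) - (2⁻¹ : ℝ) • b := by abel
    rw [this, norm_sub_sq_real, ← hu', inner_smul_right, norm_smul]
    norm_num
    ring
  rw [mem_sphere_iff_norm, ← h, Real.sqrt_sq (norm_nonneg _)]

/-- Fubini in the `j`-th point alone: moving it leaves the simplex `s` and its lift unchanged, and
its forbidden positions lie on a sphere. -/
lemma ae_lift_ne {n : ℕ} (hd : 1 ≤ d) (s : Idx d n) {j : Fin n} (hj : j ∉ s.1) :
    ∀ᵐ x : Fin n → Pt d, (vertexMatrix (verts x s)).det ≠ 0 →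
      lift (verts x s) (x j) ≠ ‖x j‖ ^ 2 := by
  have hmeas : MeasurableSet {x : Fin n → Pt d | (vertexMatrix (verts x s)).det ≠ 0 →
      lift (verts x s) (x j) ≠ ‖x j‖ ^ 2} := by
    have : {x : Fin n → Pt d | (vertexMatrix (verts x s)).det ≠ 0 →
      lift (verts x s) (x j) ≠ ‖x j‖ ^ 2} = {x | (vertexMatrix (verts x s)).det ≠ 0}ᶜ ∪
        {x | lift (verts x s) (x j) = ‖x j‖ ^ 2}ᶜ := by
      ext x; simp [imp_iff_not_or]
    rw [this]
    refine (measurableSet_det_verts_ne_zero s).compl.union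
      (measurableSet_eq_fun (measurable_lift_verts s j) ?_).compl
    exact ((measurable_pi_apply j).norm).pow_const 2
  refine ae_mem_of_ae_add_linearMap_mem (LinearMap.single ℝ (fun _ : Fin n => Pt d) j)
    (μ := volume) volume hmeas fun y => ?_
  have hv : ∀ u : Pt d, verts (y + LinearMap.single ℝ (fun _ : Fin n => Pt d) j u) s
      = verts y s := by
    intro u
    funext k
    have : enum s k ≠ j := fun h => hj (h ▸ enum_mem s k)
    simp [verts, this]
  by_cases hdet : (vertexMatrix (verts y s)).det = 0
  · exact Eventually.of_forall fun u h => absurd hdet (by rwa [hv] at h)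
  obtain ⟨a, b, hab, -⟩ := exists_lift_eq hdet
  refine measure_mono_null (fun u hu => ?_) (volume_sphere_like_eq_zero hd a b (y j))
  have : ¬ ((vertexMatrix (verts (y + LinearMap.single ℝ (fun _ : Fin n => Pt d) j u) s)).det ≠ 0 →
      lift (verts (y + LinearMap.single ℝ (fun _ : Fin n => Pt d) j u) s)
        ((y + LinearMap.single ℝ (fun _ : Fin n => Pt d) j u) j)
      ≠ ‖(y + LinearMap.single ℝ (fun _ : Fin n => Pt d) j u) j‖ ^ 2) := hu
  rw [hv] at this
  push Not at this
  have h2 := this.2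
  rw [hab] at h2
  simpa using h2

lemma ae_genPos (hd : 1 ≤ d) (n : ℕ) : ∀ᵐ x : Fin n → Pt d, GenPos x := by
  have h1 : ∀ᵐ x : Fin n → Pt d, ∀ s : Idx d n, (vertexMatrix (verts x s)).det ≠ 0 :=
    ae_all_iff.2 ae_det_verts_ne_zero
  have h2 : ∀ᵐ x : Fin n → Pt d, ∀ s : Idx d n, ∀ j, j ∉ s.1 →
      (vertexMatrix (verts x s)).det ≠ 0 → lift (verts x s) (x j) ≠ ‖x j‖ ^ 2 := by
    refine ae_all_iff.2 fun s => ae_all_iff.2 fun j => ?_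
    by_cases hj : j ∈ s.1
    · exact Eventually.of_forall fun x h => absurd hj h
    · filter_upwards [ae_lift_ne hd s hj] with x hx _ using hx
  filter_upwards [h1, h2] with x hx1 hx2 s using ⟨hx1 s, fun j hj => hx2 s j hj (hx1 s)⟩

lemma exists_bary_eq {p : Fin (d + 1) → Pt d} (hp : (vertexMatrix p).det ≠ 0)
    (k : Fin (d + 1)) : ∃ (a : ℝ) (b : Pt d), ∀ z, bary p z k = a + inner ℝ z b := by
  obtain ⟨⟨a, b⟩, h⟩ := exists_affine_interp hp (Pi.single k 1)
  refine ⟨a, b, fun z => ?_⟩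
  rw [← linear_comb_bary_affine hp, Finset.sum_congr rfl fun l _ => by rw [h l]]
  simp [Pi.single_apply]

lemma bary_apply {p : Fin (d + 1) → Pt d} (hp : (vertexMatrix p).det ≠ 0)
    (k : Fin (d + 1)) : bary p (p k) = Pi.single k 1 :=
  bary_unique hp (by simp) (by simp [Pi.single_apply, ite_smul])

lemma volume_bary_eq_zero {p : Fin (d + 1) → Pt d} (hp : (vertexMatrix p).det ≠ 0)
    (k : Fin (d + 1)) : volume {z | bary p z k = 0} = 0 := by
  obtain ⟨a, b, h⟩ := exists_bary_eq hp k
  let S : AffineSubspace ℝ (Pt d) :=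
    { carrier := {z | bary p z k = 0}
      smul_vsub_vadd_mem' := by
        intro c u v w hu hv hw
        simp only [Set.mem_ofPred_eq, h] at *
        simp only [vsub_eq_sub, vadd_eq_add, inner_add_left, inner_smul_left, inner_sub_left]
        simp only [conj_trivial]
        linear_combination hw + c * hu - c * hv }
  refine Measure.addHaar_affineSubspace volume S fun hS => ?_
  have : p k ∈ S := hS ▸ AffineSubspace.mem_top ℝ _ _
  have h0 : bary p (p k) k = 0 := this
  simp [bary_apply hp] at h0

end SimplicialRisk

end

/-! ### Second moments of barycentric coordinates over a simplex. -/

noncomputable section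

open scoped Topology ENNReal

namespace SimplicialRisk

variable {d : ℕ}

/-- The interior of the simplex with vertices `p k`. -/
def openSimplex (p : Fin (d + 1) → Pt d) : Set (Pt d) := {z | ∀ k, 0 < bary p z k}

lemma continuous_bary {p : Fin (d + 1) → Pt d} (hp : (vertexMatrix p).det ≠ 0)
    (k : Fin (d + 1)) : Continuous fun z => bary p z k := by
  obtain ⟨a, b, h⟩ := exists_bary_eq hp k
  simp only [h]
  fun_prop

lemma measurableSet_openSimplex {p : Fin (d + 1) → Pt d} (hp : (vertexMatrix p).det ≠ 0) :
    MeasurableSet (openSimplex p) := by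
  rw [openSimplex, Set.ofPred_forall]
  exact MeasurableSet.iInter fun k => measurableSet_lt measurable_const (continuous_bary hp k).measurable

lemma mem_convexHull_of_bary_nonneg {p : Fin (d + 1) → Pt d} (hp : (vertexMatrix p).det ≠ 0)
    {z : Pt d} (hz : ∀ k, 0 ≤ bary p z k) : z ∈ convexHull ℝ (Set.range p) := by
  rw [← sum_bary_smul hp z]
  exact (convex_convexHull ℝ _).sum_mem (fun k _ => hz k) (sum_bary hp z)
    fun k _ => subset_convexHull ℝ _ ⟨k, rfl⟩

lemma openSimplex_subset_convexHull {p : Fin (d + 1) → Pt d} (hp : (vertexMatrix p).det ≠ 0) :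
    openSimplex p ⊆ convexHull ℝ (Set.range p) :=
  fun _ hz => mem_convexHull_of_bary_nonneg hp fun k => (hz k).le

lemma volume_openSimplex_ne_top {p : Fin (d + 1) → Pt d} (hp : (vertexMatrix p).det ≠ 0) :
    volume (openSimplex p) ≠ ∞ := by
  have : Bornology.IsBounded (convexHull ℝ (Set.range p)) :=
    isBounded_convexHull.2 (Set.finite_range p).isBounded
  exact (this.subset (openSimplex_subset_convexHull hp)).measure_lt_top.ne

lemma bary_homothety {p : Fin (d + 1) → Pt d} (hp : (vertexMatrix p).det ≠ 0)
    (k : Fin (d + 1)) (r : ℝ) (z : Pt d) (l : Fin (d + 1)) :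
    bary p (AffineMap.homothety (p k) r z) l
      = r * bary p z l + (1 - r) * (Pi.single k 1 : Fin (d + 1) → ℝ) l := by
  have := bary_unique hp (c := fun l => r * bary p z l + (1 - r) * (Pi.single k 1 : Fin (d + 1) → ℝ) l)
    (z := AffineMap.homothety (p k) r z) ?_ ?_
  · rw [this]
  · rw [Finset.sum_add_distrib, ← Finset.mul_sum, ← Finset.mul_sum, sum_bary hp]; simp
  · simp only [add_smul, mul_smul, Finset.sum_add_distrib, ← Finset.smul_sum, sum_bary_smul hp]
    simp [Pi.single_apply, ite_smul, AffineMap.homothety_apply, smul_sub, sub_smul]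
    abel

/-- The homothety scales volume by `(1 - t) ^ d`, so this computes the law of one barycentric
coordinate of a uniform point: its tail is `(1 - t) ^ d`. -/
lemma image_homothety_openSimplex {p : Fin (d + 1) → Pt d} (hp : (vertexMatrix p).det ≠ 0)
    (k : Fin (d + 1)) {t : ℝ} (ht0 : 0 < t) (ht1 : t < 1) :
    AffineMap.homothety (p k) (1 - t) '' openSimplex p = {z | t < bary p z k} ∩ openSimplex p := by
  have h1 : 0 < 1 - t := by linarith
  ext z
  constructor
  · rintro ⟨u, hu, rfl⟩
    refine ⟨?_, fun l => ?_⟩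
    · change t < bary p _ k
      rw [bary_homothety hp]
      have := mul_pos h1 (hu k)
      simp only [Pi.single_eq_same]; linarith
    · rw [bary_homothety hp]
      have := mul_pos h1 (hu l)
      by_cases hl : l = k
      · subst hl; simp only [Pi.single_eq_same]; linarith
      · simpa [hl] using hu l |> fun h => mul_pos h1 h
  · rintro ⟨hz, hz'⟩
    have hz : t < bary p z k := hz
    refine ⟨AffineMap.homothety (p k) (1 - t)⁻¹ z, fun l => ?_, ?_⟩
    · rw [bary_homothety hp]
      have hmul : (1 - t) * ((1 - t)⁻¹ * bary p z l
          + (1 - (1 - t)⁻¹) * (Pi.single k 1 : Fin (d + 1) → ℝ) l)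
          = bary p z l - t * (Pi.single k 1 : Fin (d + 1) → ℝ) l := by
        field_simp; ring
      refine pos_of_mul_pos_right (b := _) (a := 1 - t) ?_ h1.le
      rw [hmul]
      by_cases hl : l = k
      · subst hl; simp only [Pi.single_eq_same]; linarith
      · simpa [hl] using hz' l
    · rw [← AffineMap.comp_apply, ← AffineMap.homothety_mul, mul_inv_cancel₀ h1.ne']
      simp

lemma integral_one_sub_pow_mul (d : ℕ) :
    ∫ t in (0 : ℝ)..1, (1 - t) ^ d * (2 * t) = 2 / ((d + 1) * (d + 2)) := by
  have h := intervalIntegral.integral_comp_sub_left (a := 0) (b := 1)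
    (fun u : ℝ => u ^ d * (2 * (1 - u))) 1
  simp only [sub_sub_cancel, sub_self, sub_zero] at h
  rw [h]
  have h2 : ∀ u : ℝ, u ^ d * (2 * (1 - u)) = 2 * u ^ d - 2 * u ^ (d + 1) := fun u => by ring
  simp only [h2]
  rw [intervalIntegral.integral_sub (Continuous.intervalIntegrable (by fun_prop) _ _)
      (Continuous.intervalIntegrable (by fun_prop) _ _),
    intervalIntegral.integral_const_mul, intervalIntegral.integral_const_mul, integral_pow,
    integral_pow]
  push_cast
  field_simp
  simp
  ring

/-- Layer-cake formula for the square: integrate the tail `(1 - t) ^ d` against `2 * t` over `[0,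
1]`. -/
lemma lintegral_bary_sq {p : Fin (d + 1) → Pt d} (hp : (vertexMatrix p).det ≠ 0)
    (k : Fin (d + 1)) :
    ∫⁻ z in openSimplex p, ENNReal.ofReal (bary p z k ^ 2)
      = ENNReal.ofReal (2 / ((d + 1) * (d + 2))) * volume (openSimplex p) := by
  have hmS := measurableSet_openSimplex hp
  have h := lintegral_comp_eq_lintegral_meas_lt_mul (volume.restrict (openSimplex p))
    (f := fun z => bary p z k) (g := fun t => 2 * t)
    ((ae_restrict_iff' hmS).2 (Eventually.of_forall fun z hz => (hz k).le))
    (continuous_bary hp k).aemeasurable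
    (fun t _ => Continuous.intervalIntegrable (by fun_prop) _ _)
    ((ae_restrict_iff' measurableSet_Ioi).2 (Eventually.of_forall fun t ht => by
      have : (0 : ℝ) < t := ht
      positivity))
  have hint : ∀ b : ℝ, ∫ t in (0 : ℝ)..b, 2 * t = b ^ 2 := fun b => by
    rw [intervalIntegral.integral_const_mul, integral_id]; ring
  simp only [hint] at h
  rw [h]
  have hle : ∀ z ∈ openSimplex p, bary p z k ≤ 1 := fun z hz => by
    rw [← sum_bary hp z]
    exact Finset.single_le_sum (fun l _ => (hz l).le) (Finset.mem_univ k)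
  have hms : ∀ t : ℝ, MeasurableSet {z | t < bary p z k} := fun t =>
    measurableSet_lt measurable_const (continuous_bary hp k).measurable
  have key : ∀ t ∈ Set.Ioi (0 : ℝ),
      (volume.restrict (openSimplex p)) {z | t < bary p z k} * ENNReal.ofReal (2 * t)
        = (Set.Ioo (0 : ℝ) 1).indicator
          (fun t => volume (openSimplex p) * ENNReal.ofReal ((1 - t) ^ d * (2 * t))) t := by
    intro t ht
    have ht0 : 0 < t := ht
    rw [Measure.restrict_apply (hms t)]
    rcases lt_or_ge t 1 with h1 | h1
    · rw [← image_homothety_openSimplex hp k ht0 h1, Measure.addHaar_image_homothety,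
        Set.indicator_of_mem (show t ∈ Set.Ioo (0 : ℝ) 1 from ⟨ht0, h1⟩)]
      have h1t : 0 ≤ 1 - t := by linarith
      rw [finrank_euclideanSpace_fin, abs_of_nonneg (by positivity),
        ENNReal.ofReal_mul (pow_nonneg h1t d), mul_comm (ENNReal.ofReal _), mul_assoc]
    · have he : {z | t < bary p z k} ∩ openSimplex p = ∅ := by
        ext z
        simp only [Set.mem_inter_iff, Set.mem_ofPred_eq, Set.mem_empty_iff_false, iff_false,
          not_and]
        intro h2 h3
        linarith [hle z h3]
      rw [he]
      rw [Set.indicator_of_notMem (fun hh => absurd hh.2 (not_lt.2 h1))]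
      simp
  rw [setLIntegral_congr_fun measurableSet_Ioi key, lintegral_indicator measurableSet_Ioo,
    Measure.restrict_restrict measurableSet_Ioo,
    Set.inter_eq_left.2 (fun t ht => ht.1), lintegral_const_mul' _ _ (volume_openSimplex_ne_top hp),
    ← integral_one_sub_pow_mul, intervalIntegral.integral_of_le zero_le_one, integral_Ioc_eq_integral_Ioo,
    ofReal_integral_eq_lintegral_ofReal, mul_comm]
  · exact (Continuous.integrableOn_Icc (by fun_prop)).mono_set Set.Ioo_subset_Icc_self
  · refine (ae_restrict_iff' measurableSet_Ioo).2 (Eventually.of_forall fun t ht => ?_)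
    have := ht.1
    have : 0 ≤ 1 - t := by linarith [ht.2]
    simp only [Pi.zero_apply]
    positivity

/-- All `d + 1` coordinates have the same second moment `2 / ((d + 1) * (d + 2))`. This is where the
constant of the theorem comes from. -/
lemma setIntegral_sum_bary_sq {p : Fin (d + 1) → Pt d} (hp : (vertexMatrix p).det ≠ 0) :
    ∫ z in openSimplex p, ∑ k, bary p z k ^ 2 = 2 / (d + 2) * volume.real (openSimplex p) := by
  rw [integral_eq_lintegral_of_nonneg_ae (Eventually.of_forall fun z => by positivity)
    (by have := continuous_bary hp; fun_prop)]
  have : ∀ z, ENNReal.ofReal (∑ k, bary p z k ^ 2) = ∑ k, ENNReal.ofReal (bary p z k ^ 2) :=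
    fun z => ENNReal.ofReal_sum_of_nonneg fun k _ => sq_nonneg _
  simp only [this]
  rw [lintegral_finsetSum (f := fun k z => ENNReal.ofReal (bary p z k ^ 2)) _ fun k _ =>
    ((continuous_bary hp k).pow 2).measurable.ennreal_ofReal]
  simp only [lintegral_bary_sq hp]
  rw [Finset.sum_const, Finset.card_univ, Fintype.card_fin, nsmul_eq_mul, ENNReal.toReal_mul,
    ENNReal.toReal_mul, ENNReal.toReal_ofReal (by positivity), measureReal_def]
  simp only [ENNReal.toReal_natCast]
  push_cast
  field_simp

end SimplicialRisk

end

/-! ### Interpolation on cells; smallness of cells where the points are dense. -/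

noncomputable section

open scoped Topology ENNReal

namespace SimplicialRisk

variable {d : ℕ}

lemma Cell.mem_openSimplex {n : ℕ} {x : Fin n → Pt d} {s : Idx d n} {z : Pt d}
    (h : Cell x s z) : z ∈ openSimplex (verts x s) := h.2.1

lemma Cell.mem_hull {n : ℕ} {x : Fin n → Pt d} {s : Idx d n} {z : Pt d}
    (h : Cell x s z) : z ∈ hull x s.1 :=
  (mem_hull_iff h.1 z).2 fun k => (h.2.1 k).le

lemma hull_subset_convexHull_range {n : ℕ} (x : Fin n → Pt d) (s : Finset (Fin n)) :
    hull x s ⊆ convexHull ℝ (Set.range x) :=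
  convexHull_mono (Set.image_subset_range x _)

/-- `z` lies on no hyperplane spanned by a facet of a simplex with vertices at the points. -/
def OffFacets {n : ℕ} (x : Fin n → Pt d) (z : Pt d) : Prop :=
  ∀ (s : Idx d n) (k : Fin (d + 1)), bary (verts x s) z k ≠ 0

lemma GenPos.ae_offFacets {n : ℕ} {x : Fin n → Pt d} (hx : GenPos x) :
    ∀ᵐ z : Pt d, OffFacets x z :=
  ae_all_iff.2 fun s => ae_all_iff.2 fun k => by
    have := volume_bary_eq_zero (hx s).1 k
    rw [ae_iff]
    simpa using this

lemma GenPos.affineSpan_eq_top {n : ℕ} (hn : d < n) {x : Fin n → Pt d} (hx : GenPos x) :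
    affineSpan ℝ (Set.range x) = ⊤ := by
  obtain ⟨s, -, hs⟩ := Finset.exists_subset_card_eq (s := (Finset.univ : Finset (Fin n)))
    (n := d + 1) (by simpa using hn)
  have hind := det_vertexMatrix_ne_zero_iff.1 (hx ⟨s, hs⟩).1
  have htop := hind.affineSpan_eq_top_iff_card_eq_finrank_add_one.2 (by simp)
  rw [eq_top_iff, ← htop]
  refine affineSpan_mono ℝ ?_
  rintro _ ⟨k, rfl⟩
  exact ⟨_, rfl⟩

/-- With circumcenter `c` and radius `r`, the lift at `u` is `‖u‖ ^ 2 + r ^ 2 - dist u c ^ 2`, since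
this expression is affine in `u` and correct at the vertices. Thus `r ≤ dist (x j) c` gives the
inequality. -/
lemma IsDelaunay.lift_le {n : ℕ} {x : Fin n → Pt d} {T : Finset (Finset (Fin n))}
    (hT : IsDelaunay x T) {s : Idx d n} (hs : s.1 ∈ T) (j : Fin n) :
    lift (verts x s) (x j) ≤ ‖x j‖ ^ 2 := by
  have hdet := (affineIndependent_subtype_iff s).1 (hT.nondegenerate _ hs)
  obtain ⟨c, r, h1, h2⟩ := hT.empty_ball _ hs
  have hr : 0 ≤ r := by rw [← h1 _ (enum_mem s 0)]; exact dist_nonneg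
  have hsq : ∀ u : Pt d, dist u c ^ 2 = ‖u‖ ^ 2 - 2 * inner ℝ u c + ‖c‖ ^ 2 := fun u => by
    rw [dist_eq_norm, norm_sub_sq_real]
  have hv : ∀ k, ‖verts x s k‖ ^ 2 = (r ^ 2 - ‖c‖ ^ 2) + inner ℝ (verts x s k) ((2 : ℝ) • c) := by
    intro k
    have := hsq (verts x s k)
    rw [show dist (verts x s k) c = r from h1 _ (enum_mem s k)] at this
    rw [inner_smul_right]
    linarith
  rw [lift, Finset.sum_congr rfl fun k _ => by rw [hv k], linear_comb_bary_affine hdet,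
    inner_smul_right]
  have := hsq (x j)
  have h3 := pow_le_pow_left₀ hr (h2 j) 2
  linarith

lemma IsDelaunay.cell_of_mem_hull {n : ℕ} {x : Fin n → Pt d} {T : Finset (Finset (Fin n))}
    (hT : IsDelaunay x T) {s : Idx d n} (hs : s.1 ∈ T) {z : Pt d} (hz : OffFacets x z)
    (hmem : z ∈ hull x s.1) : Cell x s z := by
  have hdet := (affineIndependent_subtype_iff s).1 (hT.nondegenerate _ hs)
  exact ⟨hdet, fun k => lt_of_le_of_ne ((mem_hull_iff hdet z).1 hmem k) (hz s k).symm,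
    hT.lift_le hs⟩

lemma IsDelaunay.exists_cell {n : ℕ} {x : Fin n → Pt d} {T : Finset (Finset (Fin n))}
    (hT : IsDelaunay x T) {z : Pt d} (hz : OffFacets x z)
    (hmem : z ∈ convexHull ℝ (Set.range x)) : ∃ s, Cell x s z := by
  rw [← hT.cover] at hmem
  simp only [Set.mem_iUnion] at hmem
  obtain ⟨s, hs, hzs⟩ := hmem
  exact ⟨⟨s, hT.card_eq s hs⟩, hT.cell_of_mem_hull (s := ⟨s, hT.card_eq s hs⟩) hs hz hzs⟩

open Classical in
/-- Simplicial interpolation with respect to the cells. -/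
def interp {n : ℕ} (x : Fin n → Pt d) (y : Fin n → ℝ) (z : Pt d) : ℝ :=
  1 / 2 + ∑ s : Idx d n,
    if Cell x s z then ∑ k, bary (verts x s) z k * y (enum s k) - 1 / 2 else 0

lemma GenPos.interp_eq {n : ℕ} {x : Fin n → Pt d} (hx : GenPos x) {s : Idx d n} {z : Pt d}
    (hs : Cell x s z) (y : Fin n → ℝ) :
    interp x y z = ∑ k, bary (verts x s) z k * y (enum s k) := by
  classical
  rw [interp, Finset.sum_eq_single s, if_pos hs]
  · ring
  · intro t _ ht
    rw [if_neg fun h => ht (hx.cell_unique h hs)]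
  · simp

lemma interp_eq_half {n : ℕ} {x : Fin n → Pt d} {z : Pt d} (h : ∀ s, ¬ Cell x s z)
    (y : Fin n → ℝ) : interp x y z = 1 / 2 := by
  simp [interp, h]

/-- This eliminates the scheme: the right side does not involve `T` and is jointly measurable in
points, labels and `z`. -/
lemma IsDelaunay.simplicialInterp_eq {n : ℕ} {x : Fin n → Pt d} {T : Finset (Finset (Fin n))}
    (hT : IsDelaunay x T) (hx : GenPos x) (y : Fin n → ℝ) {z : Pt d} (hz : OffFacets x z) :
    simplicialInterp T x y z = interp x y z := by
  by_cases h : ∃ s ∈ T, z ∈ hull x s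
  · have hc := hT.card_eq _ h.choose_spec.1
    have hcell := hT.cell_of_mem_hull (s := ⟨h.choose, hc⟩) h.choose_spec.1 hz h.choose_spec.2
    rw [simplicialInterp, dif_pos h, hx.interp_eq hcell]
    exact linearInterp_eq (s := ⟨h.choose, hc⟩) hcell.1 y z
  · rw [simplicialInterp, dif_neg h, interp_eq_half]
    intro s hs
    -- A cell lies in the convex hull of the points, which `T` covers; so outside all simplices of
    -- `T` both sides take the default value `1 / 2`.
    have := hull_subset_convexHull_range x _ hs.mem_hull
    rw [← hT.cover] at this
    simp only [Set.mem_iUnion] at this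
    obtain ⟨t, ht, hzt⟩ := this
    exact h ⟨t, ht, hzt⟩

lemma measurable_interp {n : ℕ} :
    Measurable fun q : ((Fin n → Pt d) × (Fin n → ℝ)) × Pt d => interp q.1.1 q.1.2 q.2 := by
  classical
  have hq : Measurable fun q : ((Fin n → Pt d) × (Fin n → ℝ)) × Pt d => (q.1.1, q.2) := by
    fun_prop
  refine measurable_const.add (Finset.measurable_sum _ fun s _ => ?_)
  refine Measurable.ite ((measurableSet_cell s).preimage hq) ?_ measurable_const
  refine (Finset.measurable_sum _ fun k _ => ?_).sub_const _
  refine Measurable.mul ?_ ?_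
  · exact (measurable_bary_verts s k).comp hq
  · exact (measurable_pi_apply (enum s k)).comp (measurable_snd.comp measurable_fst)

lemma GenPos.interp_mem_Icc {n : ℕ} {x : Fin n → Pt d} (hx : GenPos x) {y : Fin n → ℝ}
    (hy : ∀ i, y i ∈ Set.Icc (0 : ℝ) 1) (z : Pt d) : interp x y z ∈ Set.Icc (0 : ℝ) 1 := by
  by_cases h : ∃ s, Cell x s z
  · obtain ⟨s, hs⟩ := h
    rw [hx.interp_eq hs]
    constructor
    · exact Finset.sum_nonneg fun k _ => mul_nonneg (hs.2.1 k).le (hy _).1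
    · rw [← sum_bary hs.1 z]
      exact Finset.sum_le_sum fun k _ => mul_le_of_le_one_right (hs.2.1 k).le (hy _).2
  · rw [interp_eq_half (not_exists.1 h)]
    constructor <;> norm_num

/-- Every open ball of radius `ρ` with center within distance `ρ` of `z` contains a point `x i`. -/
def DenseNear {n : ℕ} (x : Fin n → Pt d) (z : Pt d) (ρ : ℝ) : Prop :=
  ∀ c, dist c z ≤ ρ → ∃ i, dist (x i) c < ρ

/-- Otherwise a hyperplane separates `z` from the points. The ball of radius `ρ` that touches the
parallel hyperplane through `z` at `z`, on the side away from the points, contains none of them. -/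
lemma DenseNear.mem_convexHull {n : ℕ} {x : Fin n → Pt d} {z : Pt d} {ρ : ℝ} (hρ : 0 < ρ)
    (h : DenseNear x z ρ) : z ∈ convexHull ℝ (Set.range x) := by
  by_contra hz
  have hcl : IsClosed (convexHull ℝ (Set.range x)) :=
    (Set.finite_range x).isClosed_convexHull ℝ
  obtain ⟨f, u, hf1, hf2⟩ := geometric_hahn_banach_closed_point (convex_convexHull ℝ _) hcl hz
  obtain ⟨b, rfl⟩ := (InnerProductSpace.toDual ℝ (Pt d)).surjective f
  simp only [InnerProductSpace.toDual_apply_apply] at hf1 hf2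
  have hlt : ∀ i, inner ℝ b (x i - z) < 0 := fun i => by
    rw [inner_sub_right]
    linarith [hf1 _ (subset_convexHull ℝ _ ⟨i, rfl⟩)]
  have hb : b ≠ 0 := by
    rintro rfl
    obtain ⟨i, -⟩ := h z (by simpa using hρ.le)
    simpa using hlt i
  have hb' : 0 < ‖b‖ := norm_pos_iff.2 hb
  obtain ⟨i, hi⟩ := h (z + (ρ / ‖b‖) • b) (by
    rw [dist_eq_norm, add_sub_cancel_left, norm_smul, Real.norm_eq_abs,
      abs_of_pos (by positivity), div_mul_cancel₀ _ hb'.ne'])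
  have h1 : dist (x i) (z + (ρ / ‖b‖) • b) ^ 2 < ρ ^ 2 :=
    pow_lt_pow_left₀ hi dist_nonneg two_ne_zero
  have h2 : x i - (z + (ρ / ‖b‖) • b) = (x i - z) - (ρ / ‖b‖) • b := by abel
  rw [dist_eq_norm, h2, norm_sub_sq_real, inner_smul_right, norm_smul, Real.norm_eq_abs,
      abs_of_pos (a := ρ / ‖b‖) (by positivity), div_mul_cancel₀ _ hb'.ne', real_inner_comm] at h1
  have h3 : ρ / ‖b‖ * inner ℝ b (x i - z) < 0 := mul_neg_of_pos_of_neg (by positivity) (hlt i)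
  nlinarith [sq_nonneg ‖x i - z‖]

/-- The point `z` lies in the circumscribed ball, of center `c` and radius `r`, whose interior
contains no point. If `r > ρ`, going the fraction `ρ / r` of the way from `z` to `c` moves by at
most `ρ` and reaches the center of a ball of radius `ρ` inside this ball, against density. So `r ≤
ρ`. -/
lemma DenseNear.dist_vertex_le {n : ℕ} {x : Fin n → Pt d} {s : Idx d n} {z : Pt d} {ρ : ℝ}
    (hρ : 0 < ρ) (h : DenseNear x z ρ) (hs : Cell x s z) (k l : Fin (d + 1)) :
    dist (verts x s k) (verts x s l) ≤ 2 * ρ := by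
  obtain ⟨a, b, hab, hv⟩ := exists_lift_eq hs.1
  -- Center and radius of the circumscribed sphere, read off from the lift `a + inner ℝ z b` by
  -- completing the square.
  set c : Pt d := (2⁻¹ : ℝ) • b with hc
  set r : ℝ := √(a + ‖b‖ ^ 2 / 4) with hr
  have hsq : ∀ u : Pt d, dist u c ^ 2 = ‖u‖ ^ 2 - inner ℝ u b + ‖b‖ ^ 2 / 4 := fun u => by
    rw [dist_eq_norm, norm_sub_sq_real, hc, inner_smul_right, norm_smul]
    norm_num
    ring
  have hvr : ∀ k, dist (verts x s k) c = r := fun k => by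
    rw [hr, show a + ‖b‖ ^ 2 / 4 = dist (verts x s k) c ^ 2 by rw [hsq, ← hv k]; ring,
      Real.sqrt_sq dist_nonneg]
  have hxr : ∀ j, r ≤ dist (x j) c := fun j => by
    rw [hr]
    refine Real.sqrt_le_iff.2 ⟨dist_nonneg, ?_⟩
    have := hs.2.2 j
    rw [hab] at this
    rw [hsq]
    linarith
  have hzr : dist z c ≤ r := by
    have hsub : convexHull ℝ (Set.range (verts x s)) ⊆ Metric.closedBall c r :=
      convexHull_min (by rintro _ ⟨k, rfl⟩; exact (hvr k).le) (convex_closedBall c r)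
    exact hsub (openSimplex_subset_convexHull hs.1 hs.mem_openSimplex)
  have hrρ : r ≤ ρ := by
    by_contra hlt
    push Not at hlt
    have hr0 : 0 < r := hρ.trans hlt
    have ht : ρ / r ≤ 1 := (div_le_one hr0).2 hlt.le
    have ht0 : 0 < ρ / r := by positivity
    obtain ⟨i, hi⟩ := h (AffineMap.lineMap z c (ρ / r)) (by
      rw [dist_lineMap_left, Real.norm_eq_abs, abs_of_pos ht0]
      calc ρ / r * dist z c ≤ ρ / r * r := by gcongr
        _ = ρ := div_mul_cancel₀ _ hr0.ne')
    have h1 : dist (AffineMap.lineMap z c (ρ / r)) c ≤ r - ρ := by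
      rw [dist_lineMap_right, Real.norm_eq_abs, abs_of_nonneg (by linarith)]
      calc (1 - ρ / r) * dist z c ≤ (1 - ρ / r) * r := by gcongr
        _ = r - ρ := by field_simp
    have h2 := dist_triangle (x i) (AffineMap.lineMap z c (ρ / r)) c
    linarith [hxr i]
  calc dist (verts x s k) (verts x s l) ≤ dist (verts x s k) c + dist (verts x s l) c :=
        dist_triangle_right _ _ _
    _ ≤ 2 * ρ := by rw [hvr, hvr]; linarith

/-- The simplex with index set `s` has diameter at most `δ`. -/
def Small {n : ℕ} (δ : ℝ) (x : Fin n → Pt d) (s : Idx d n) : Prop :=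
  ∀ k l, dist (verts x s k) (verts x s l) ≤ δ

/-- A small cell, as a set of pairs of a configuration of points and a point of the cell. -/
def smallCell {n : ℕ} (δ : ℝ) (s : Idx d n) : Set ((Fin n → Pt d) × Pt d) :=
  {q | Cell q.1 s q.2 ∧ Small δ q.1 s}

lemma measurableSet_smallCell {n : ℕ} (δ : ℝ) (s : Idx d n) :
    MeasurableSet (smallCell (d := d) δ s) := by
  refine (measurableSet_cell s).inter ?_
  change MeasurableSet {q : (Fin n → Pt d) × Pt d |
    ∀ k l, dist (verts q.1 s k) (verts q.1 s l) ≤ δ}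
  rw [Set.ofPred_forall]
  refine MeasurableSet.iInter fun k => ?_
  rw [Set.ofPred_forall]
  refine MeasurableSet.iInter fun l => measurableSet_le ?_ measurable_const
  exact (((measurable_pi_apply _).comp measurable_fst)).dist
    ((measurable_pi_apply _).comp measurable_fst)

lemma IsDelaunay.exists_mem_smallCell {n : ℕ} {x : Fin n → Pt d} {T : Finset (Finset (Fin n))}
    (hT : IsDelaunay x T) {z : Pt d} (hz : OffFacets x z) {ρ δ : ℝ} (hρ : 0 < ρ)
    (h : DenseNear x z ρ) (hδ : 2 * ρ ≤ δ) : ∃ s, (x, z) ∈ smallCell δ s := by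
  obtain ⟨s, hs⟩ := hT.exists_cell hz (h.mem_convexHull hρ)
  exact ⟨s, hs, fun k l => (h.dist_vertex_le hρ hs k l).trans hδ⟩

/-- Halving the radius reduces density to finitely many balls, so that a union bound becomes
available. -/
lemma exists_finite_net_denseNear (z : Pt d) {ρ : ℝ} (hρ : 0 < ρ) :
    ∃ F : Finset (Pt d), (∀ q ∈ F, dist q z ≤ ρ) ∧
      ∀ (n : ℕ) (x : Fin n → Pt d), (∀ q ∈ F, ∃ i, dist (x i) q < ρ / 2) → DenseNear x z ρ := by
  obtain ⟨F, hF, hFfin, hcov⟩ := totallyBounded_iff_subset.1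
    (isCompact_closedBall z ρ).totallyBounded _ (Metric.dist_mem_uniformity (half_pos hρ))
  refine ⟨hFfin.toFinset, fun q hq => hF (hFfin.mem_toFinset.1 hq), fun n x hx c hc => ?_⟩
  have := hcov (Metric.mem_closedBall.2 hc)
  simp only [Set.mem_iUnion, Set.mem_ofPred_eq] at this
  obtain ⟨q, hq, hcq⟩ := this
  obtain ⟨i, hi⟩ := hx q (hFfin.mem_toFinset.2 hq)
  refine ⟨i, ?_⟩
  have h2 := dist_triangle_right (x i) c q
  have hcq : dist c q < ρ / 2 := hcq
  linarith

end SimplicialRisk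

end

/-! ### The regression model and the bias-variance decomposition. -/

noncomputable section

open scoped Topology ENNReal

namespace SimplicialRisk

variable {d : ℕ}

lemma integrable_of_abs_le {Ω : Type*} [MeasurableSpace Ω] {P : Measure Ω} [IsFiniteMeasure P]
    {f : Ω → ℝ} (hf : Measurable f) {B : ℝ} (hB : ∀ x, |f x| ≤ B) : Integrable f P :=
  Integrable.of_bound hf.aestronglyMeasurable B (Eventually.of_forall hB)

/-- The label, truncated to `[0, 1]`. -/
def label (q : Pt d × ℝ) : ℝ := max 0 (min 1 q.2)

lemma measurable_label : Measurable (label (d := d)) := by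
  unfold label; fun_prop

lemma label_mem_Icc (q : Pt d × ℝ) : label q ∈ Set.Icc (0 : ℝ) 1 :=
  ⟨le_max_left _ _, max_le zero_le_one (min_le_left _ _)⟩

lemma label_eq {q : Pt d × ℝ} (h : q.2 = 0 ∨ q.2 = 1) : label q = q.2 := by
  rcases h with h | h <;> simp [label, h]

/-- `g` is the regression function of the law `ν` of a random pair with labels in `{0, 1}`. -/
structure IsRegression (ν : Measure (Pt d × ℝ)) (g : Pt d → ℝ) : Prop where
  continuous : Continuous g
  mem_Icc : ∀ z, g z ∈ Set.Icc (0 : ℝ) 1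
  binary : ∀ᵐ q ∂ν, q.2 = 0 ∨ q.2 = 1
  cond_mean : ∀ (ψ : Pt d → ℝ) (B : ℝ), Measurable ψ → (∀ z, |ψ z| ≤ B) →
    ∫ q, ψ q.1 * (label q - g q.1) ∂ν = 0

variable {ν : Measure (Pt d × ℝ)} {g : Pt d → ℝ}

lemma IsRegression.abs_noise_le (h : IsRegression ν g) (q : Pt d × ℝ) :
    |label q - g q.1| ≤ 1 := by
  have h1 := label_mem_Icc q
  have h2 := h.mem_Icc q.1
  rw [abs_le]
  constructor <;> linarith [h1.1, h1.2, h2.1, h2.2]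

lemma IsRegression.measurable_noise (h : IsRegression ν g) :
    Measurable fun q : Pt d × ℝ => label q - g q.1 :=
  measurable_label.sub (h.continuous.measurable.comp measurable_fst)

/-- Labels satisfy `y ^ 2 = y`. In this form `cond_mean` also evaluates the squared noise: the first
term averages to zero, the second depends on the point alone. -/
lemma IsRegression.ae_noise_sq (h : IsRegression ν g) :
    ∀ᵐ q ∂ν, (label q - g q.1) ^ 2
      = (1 - 2 * g q.1) * (label q - g q.1) + g q.1 * (1 - g q.1) := by
  filter_upwards [h.binary] with q hq
  rw [label_eq hq]
  rcases hq with hq | hq <;> rw [hq] <;> ring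

variable [IsProbabilityMeasure ν]

/-- The noise of an example is orthogonal to any function which does not depend on its label. -/
lemma IsRegression.integral_mul_noise (h : IsRegression ν g) {n : ℕ} (i : Fin n)
    {φ : (Fin n → Pt d × ℝ) → ℝ} (hφ : Measurable φ) {B : ℝ} (hB : ∀ D, |φ D| ≤ B)
    (hind : ∀ D t, φ (Function.update D i ((D i).1, t)) = φ D) :
    ∫ D, φ D * (label (D i) - g (D i).1) ∂(Measure.pi fun _ : Fin n => ν) = 0 := by
  obtain _ | n := n
  · exact i.elim0
  have hmp := (measurePreserving_piFinSuccAbove (fun _ : Fin (n + 1) => ν) i).symm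
  rw [← hmp.integral_comp']
  set e := (MeasurableEquiv.piFinSuccAbove (fun _ : Fin (n + 1) => Pt d × ℝ) i).symm with he
  have hea : ∀ a, e a = i.insertNth (α := fun _ => Pt d × ℝ) a.1 a.2 := fun _ => rfl
  have hei : ∀ a, (e a) i = a.1 := fun a => by simp [hea]
  rw [integral_prod_symm]
  · refine integral_eq_zero_of_ae (Eventually.of_forall fun r => ?_)
    -- Resetting the `i`-th label to `0` exhibits `φ`, for fixed other examples, as a function of
    -- the `i`-th point only, as `cond_mean` requires.
    have key : ∀ a : Pt d × ℝ, φ (e (a, r)) = φ (e ((a.1, 0), r)) := fun a => by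
      rw [← hind (e (a, r)) 0, hei]
      congr 1
      simp [hea]
    simp only [hei, Pi.zero_apply]
    rw [integral_congr_ae (Eventually.of_forall fun a =>
      congrArg (· * (label a - g a.1)) (key a))]
    exact h.cond_mean (fun u => φ (e ((u, 0), r))) B (by fun_prop) fun z => hB _
  · refine integrable_of_abs_le (B := B * 1) ?_ fun a => ?_
    · refine (hφ.comp e.measurable).mul (h.measurable_noise.comp ?_)
      exact (measurable_pi_apply i).comp e.measurable
    · rw [abs_mul]
      exact mul_le_mul (hB _) (h.abs_noise_le _) (abs_nonneg _) ((abs_nonneg _).trans (hB (e a)))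

lemma ae_pi_of_ae {n : ℕ} {p : Pt d × ℝ → Prop} (hp : ∀ᵐ q ∂ν, p q) :
    ∀ᵐ D ∂(Measure.pi fun _ : Fin n => ν), ∀ i, p (D i) :=
  ae_all_iff.2 fun i => (measurePreserving_eval (fun _ : Fin n => ν) i).quasiMeasurePreserving.ae hp

/-- The expansion is arranged so that the factor multiplying `ξ k` in the second sum does not
contain `ξ k`; each term then vanishes by orthogonality of the noise. -/
lemma sq_sum_add_eq {m : ℕ} (c ξ : Fin m → ℝ) (b : ℝ) :
    (∑ k, c k * ξ k + b) ^ 2 = ∑ k, c k ^ 2 * ξ k ^ 2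
      + ∑ k, (c k * ∑ l ∈ Finset.univ.erase k, c l * ξ l + 2 * c k * b) * ξ k + b ^ 2 := by
  have h : ∀ k, c k ^ 2 * ξ k ^ 2 + (c k * ∑ l ∈ Finset.univ.erase k, c l * ξ l + 2 * c k * b) * ξ k
      = c k * ξ k * ∑ l, c l * ξ l + 2 * b * (c k * ξ k) := fun k => by
    rw [← Finset.add_sum_erase _ _ (Finset.mem_univ k)]; ring
  rw [← Finset.sum_add_distrib, Finset.sum_congr rfl fun k _ => h k, Finset.sum_add_distrib,
    ← Finset.sum_mul, ← Finset.mul_sum]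
  ring

/-- The bias-variance decomposition. -/
lemma IsRegression.integral_sq_sum_noise (h : IsRegression ν g) {n m : ℕ} {e : Fin m → Fin n}
    (he : Function.Injective e) {c : Fin m → (Fin n → Pt d) → ℝ} {b : (Fin n → Pt d) → ℝ}
    (hc : ∀ k, Measurable (c k)) (hb : Measurable b) (hc1 : ∀ k x, |c k x| ≤ 1)
    (hb1 : ∀ x, |b x| ≤ 1) :
    ∫ D, (∑ k, c k (fun i => (D i).1) * (label (D (e k)) - g (D (e k)).1)
        + b (fun i => (D i).1)) ^ 2 ∂(Measure.pi fun _ : Fin n => ν)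
      = ∫ D, (∑ k, c k (fun i => (D i).1) ^ 2 * (g (D (e k)).1 * (1 - g (D (e k)).1))
        + b (fun i => (D i).1) ^ 2) ∂(Measure.pi fun _ : Fin n => ν) := by
  set x : (Fin n → Pt d × ℝ) → Fin n → Pt d := fun D i => (D i).1 with hx
  have hxm : Measurable x := by fun_prop
  set ξ : Fin m → (Fin n → Pt d × ℝ) → ℝ := fun k D => label (D (e k)) - g (D (e k)).1 with hξ
  have hξm : ∀ k, Measurable (ξ k) := fun k => h.measurable_noise.comp (measurable_pi_apply (e k))
  have hξ1 : ∀ k D, |ξ k D| ≤ 1 := fun k D => h.abs_noise_le _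
  have hgm : ∀ k, Measurable fun D : Fin n → Pt d × ℝ => g (D (e k)).1 := fun k =>
    h.continuous.measurable.comp (measurable_fst.comp (measurable_pi_apply (e k)))
  -- The total coefficient of `ξ k`, from the linear part of `ξ k ^ 2` and from the cross terms. It
  -- is free of the label of `e k`; for the other noises this uses injectivity of `e`.
  set φ : Fin m → (Fin n → Pt d × ℝ) → ℝ := fun k D =>
    c k (x D) ^ 2 * (1 - 2 * g (D (e k)).1) + (c k (x D) *
      ∑ l ∈ Finset.univ.erase k, c l (x D) * ξ l D + 2 * c k (x D) * b (x D)) with hφ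
  have hφm : ∀ k, Measurable (φ k) := fun k => by
    have h1 := fun l => (hc l).comp hxm
    have h2 := hb.comp hxm
    have h3 : Measurable fun D => ∑ l ∈ Finset.univ.erase k, c l (x D) * ξ l D :=
      Finset.measurable_sum _ fun l _ => (h1 l).mul (hξm l)
    exact (((h1 k).pow_const 2).mul (measurable_const.sub ((hgm k).const_mul 2))).add
      (((h1 k).mul h3).add (((h1 k).const_mul 2).mul h2))
  have hφB : ∀ k D, |φ k D| ≤ 1 * 1 + (1 * m + 2 * 1 * 1) := fun k D => by
    have hg := h.mem_Icc (D (e k)).1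
    have hsum : |∑ l ∈ Finset.univ.erase k, c l (x D) * ξ l D| ≤ m := by
      refine (Finset.abs_sum_le_sum_abs _ _).trans ?_
      refine (Finset.sum_le_card_nsmul _ _ 1 fun l _ => ?_).trans ?_
      · rw [abs_mul]; exact mul_le_one₀ (hc1 _ _) (abs_nonneg _) (hξ1 _ _)
      · rw [nsmul_eq_mul, mul_one]
        exact_mod_cast (Finset.card_le_univ _).trans (by simp)
    refine (abs_add_le _ _).trans (add_le_add ?_ ((abs_add_le _ _).trans (add_le_add ?_ ?_)))
    · rw [abs_mul, abs_pow]
      refine mul_le_mul (pow_le_one₀ (abs_nonneg _) (hc1 _ _)) ?_ (abs_nonneg _) zero_le_one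
      rw [abs_le]; constructor <;> linarith [hg.1, hg.2]
    · rw [abs_mul]
      exact mul_le_mul (hc1 _ _) hsum (abs_nonneg _) zero_le_one
    · rw [abs_mul, abs_mul, abs_two]
      have := hc1 k (x D)
      exact mul_le_mul (by linarith) (hb1 _) (abs_nonneg _) (by norm_num)
  have hφ0 : ∀ k, ∫ D, φ k D * ξ k D ∂(Measure.pi fun _ : Fin n => ν) = 0 := fun k => by
    refine h.integral_mul_noise (e k) (hφm k) (hφB k) fun D t => ?_
    have hxu : x (Function.update D (e k) ((D (e k)).1, t)) = x D := by
      funext i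
      by_cases hi : i = e k
      · subst hi; simp [hx]
      · simp [hx, hi]
    have hξu : ∀ l ∈ Finset.univ.erase k, ξ l (Function.update D (e k) ((D (e k)).1, t)) = ξ l D := by
      intro l hl
      have : e l ≠ e k := fun hh => (Finset.ne_of_mem_erase hl) (he hh)
      simp [hξ, this]
    simp only [hφ, hxu]
    rw [Finset.sum_congr rfl fun l hl => by rw [hξu l hl]]
    simp
  have hφi : ∀ k, Integrable (fun D => φ k D * ξ k D) (Measure.pi fun _ : Fin n => ν) := fun k =>
    integrable_of_abs_le (B := (1 * 1 + (1 * m + 2 * 1 * 1)) * 1) ((hφm k).mul (hξm k)) fun D => by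
      rw [abs_mul]
      exact mul_le_mul (hφB k D) (hξ1 k D) (abs_nonneg _) (by positivity)
  have hw : ∀ z, |g z * (1 - g z)| ≤ 1 := fun z => by
    have hg := h.mem_Icc z
    rw [abs_of_nonneg (mul_nonneg hg.1 (by linarith [hg.2]))]
    exact mul_le_one₀ hg.2 (by linarith [hg.2]) (by linarith [hg.1])
  have hmain : Integrable (fun D : Fin n → Pt d × ℝ =>
      ∑ k, c k (x D) ^ 2 * (g (D (e k)).1 * (1 - g (D (e k)).1)) + b (x D) ^ 2)
      (Measure.pi fun _ : Fin n => ν) := by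
    refine integrable_of_abs_le (B := (m : ℝ) + 1) ?_ fun D => ?_
    · refine (Finset.measurable_sum _ fun k _ => ?_).add ((hb.comp hxm).pow_const 2)
      exact (((hc k).comp hxm).pow_const 2).mul ((hgm k).mul (measurable_const.sub (hgm k)))
    · refine (abs_add_le _ _).trans (add_le_add ?_ ?_)
      · refine (Finset.abs_sum_le_sum_abs _ _).trans ?_
        refine (Finset.sum_le_card_nsmul _ _ 1 fun l _ => ?_).trans (by simp)
        rw [abs_mul, abs_pow]
        exact mul_le_one₀ (pow_le_one₀ (abs_nonneg _) (hc1 _ _)) (abs_nonneg _) (hw _)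
      · rw [abs_pow]; exact pow_le_one₀ (abs_nonneg _) (hb1 _)
  have hae : ∀ᵐ D ∂(Measure.pi fun _ : Fin n => ν),
      (∑ k, c k (x D) * ξ k D + b (x D)) ^ 2
        = (∑ k, c k (x D) ^ 2 * (g (D (e k)).1 * (1 - g (D (e k)).1)) + b (x D) ^ 2)
          + ∑ k, φ k D * ξ k D := by
    filter_upwards [ae_pi_of_ae h.ae_noise_sq] with D hD
    rw [sq_sum_add_eq (fun k => c k (x D)) (fun k => ξ k D), Finset.sum_congr rfl fun k _ => by
      rw [show ξ k D ^ 2 = _ from hD (e k)]]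
    simp only [hφ, hξ, add_mul, mul_add, Finset.sum_add_distrib, mul_assoc]
    ring
  rw [integral_congr_ae hae, integral_add hmain (integrable_finsetSum _ fun k _ => hφi k),
    integral_finsetSum _ fun k _ => hφi k, Finset.sum_congr rfl fun k _ => hφ0 k]
  rw [Finset.sum_const_zero, add_zero]

end SimplicialRisk

end

/-! ### The error over one simplex; the law of the design. -/

noncomputable section

open scoped Topology ENNReal

namespace SimplicialRisk

variable {d : ℕ} {C : Set (Pt d)}

variable {ν : Measure (Pt d × ℝ)} {g : Pt d → ℝ}

/-- The conditional variance of a label with conditional mean `g`. -/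
def bernoulliVar (g : Pt d → ℝ) (z : Pt d) : ℝ := g z * (1 - g z)

lemma IsRegression.bernoulliVar_mem_Icc (h : IsRegression ν g) (z : Pt d) :
    bernoulliVar g z ∈ Set.Icc (0 : ℝ) 1 := by
  have hg := h.mem_Icc z
  exact ⟨mul_nonneg hg.1 (by linarith [hg.2]),
    mul_le_one₀ hg.2 (by linarith [hg.2]) (by linarith [hg.1])⟩

lemma IsRegression.abs_bernoulliVar_sub_le (h : IsRegression ν g) (u v : Pt d) :
    |bernoulliVar g u - bernoulliVar g v| ≤ |g u - g v| := by
  have hu := h.mem_Icc u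
  have hv := h.mem_Icc v
  have : bernoulliVar g u - bernoulliVar g v = (g u - g v) * (1 - g u - g v) := by unfold bernoulliVar; ring
  rw [this, abs_mul]
  refine mul_le_of_le_one_right (abs_nonneg _) ?_
  rw [abs_le]
  constructor <;> linarith [hu.1, hu.2, hv.1, hv.2]

lemma IsRegression.continuous_bernoulliVar (h : IsRegression ν g) : Continuous (bernoulliVar g) :=
  h.continuous.mul (continuous_const.sub h.continuous)

/-- The mean squared error over a small simplex. -/
lemma IsRegression.setIntegral_openSimplex_le (h : IsRegression ν g) (hCconv : Convex ℝ C)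
    {p : Fin (d + 1) → Pt d} (hp : (vertexMatrix p).det ≠ 0) (hpC : ∀ k, p k ∈ C) {δ ε : ℝ}
    (hpδ : ∀ k l, dist (p k) (p l) ≤ δ) (hε1 : ε ≤ 1)
    (hδ : ∀ u ∈ C, ∀ v ∈ C, dist u v ≤ δ → |g u - g v| ≤ ε) :
    ∫ z in openSimplex p, (∑ k, bary p z k ^ 2 * bernoulliVar g (p k)
        + (∑ k, bary p z k * g (p k) - g z) ^ 2)
      ≤ ∫ z in openSimplex p, (2 / (d + 2) * (bernoulliVar g z + 2 * ε) + ε) := by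
  have hmS := measurableSet_openSimplex hp
  have hV := volume_openSimplex_ne_top hp
  have hε0 : 0 ≤ ε := (abs_nonneg _).trans (hδ _ (hpC 0) _ (hpC 0) (hpδ 0 0))
  have hSC : ∀ z ∈ openSimplex p, z ∈ C := fun z hz =>
    convexHull_min (by rintro _ ⟨k, rfl⟩; exact hpC k) hCconv
      (openSimplex_subset_convexHull hp hz)
  have hzk : ∀ z ∈ openSimplex p, ∀ k, dist z (p k) ≤ δ := fun z hz k =>
    convexHull_min (by rintro _ ⟨l, rfl⟩; exact hpδ l k) (convex_closedBall (p k) δ)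
      (openSimplex_subset_convexHull hp hz)
  have hle1 : ∀ z ∈ openSimplex p, ∀ k, bary p z k ≤ 1 := fun z hz k => by
    rw [← sum_bary hp z]
    exact Finset.single_le_sum (fun l _ => (hz l).le) (Finset.mem_univ k)
  have hcont : ∀ k, Continuous fun z => bary p z k := continuous_bary hp
  have hgc := h.continuous
  have hwc := h.continuous_bernoulliVar
  have hIntOn : ∀ f : Pt d → ℝ, Continuous f → IntegrableOn f (openSimplex p) := fun f hf => by
    have hK : IsCompact (convexHull ℝ (Set.range p)) := (Set.finite_range p).isCompact_convexHull ℝ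
    exact (hf.continuousOn.integrableOn_compact hK).mono_set (openSimplex_subset_convexHull hp)
  -- The variance is frozen at one vertex: one `ε` pays for passing from the other vertices to `p
  -- 0`, a second one for passing from `p 0` to `z`.
  set W := bernoulliVar g (p 0) with hW
  calc ∫ z in openSimplex p, (∑ k, bary p z k ^ 2 * bernoulliVar g (p k)
        + (∑ k, bary p z k * g (p k) - g z) ^ 2)
      ≤ ∫ z in openSimplex p, ((∑ k, bary p z k ^ 2) * (W + ε) + ε) := by
        refine setIntegral_mono_on (hIntOn _ (by fun_prop)) (hIntOn _ (by fun_prop)) hmS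
          fun z hz => add_le_add ?_ ?_
        · rw [Finset.sum_mul]
          refine Finset.sum_le_sum fun k _ => mul_le_mul_of_nonneg_left ?_ (sq_nonneg _)
          have := (h.abs_bernoulliVar_sub_le (p k) (p 0)).trans (hδ _ (hpC k) _ (hpC 0) (hpδ k 0))
          linarith [(abs_le.1 this).2]
        · have hb : |∑ k, bary p z k * g (p k) - g z| ≤ ε := by
            have : ∑ k, bary p z k * g (p k) - g z = ∑ k, bary p z k * (g (p k) - g z) := by
              simp only [mul_sub, Finset.sum_sub_distrib, ← Finset.sum_mul, sum_bary hp, one_mul]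
            rw [this]
            calc |∑ k, bary p z k * (g (p k) - g z)|
                ≤ ∑ k, bary p z k * ε := by
                  refine (Finset.abs_sum_le_sum_abs _ _).trans (Finset.sum_le_sum fun k _ => ?_)
                  rw [abs_mul, abs_of_pos (hz k)]
                  refine mul_le_mul_of_nonneg_left ?_ (hz k).le
                  exact hδ _ (hpC k) _ (hSC z hz) (by rw [dist_comm]; exact hzk z hz k)
              _ = ε := by rw [← Finset.sum_mul, sum_bary hp, one_mul]
          rw [← sq_abs]
          -- The squared bias is at most `ε ^ 2`, hence at most `ε` because `ε ≤ 1`.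
          nlinarith [abs_nonneg (∑ k, bary p z k * g (p k) - g z)]
    _ = ∫ z in openSimplex p, (2 / (d + 2) * (W + ε) + ε) := by
        rw [integral_add (hIntOn _ (by fun_prop)) (hIntOn _ (by fun_prop)), integral_mul_const,
          setIntegral_sum_bary_sq hp, setIntegral_const, setIntegral_const, smul_eq_mul,
          smul_eq_mul]
        ring
    _ ≤ ∫ z in openSimplex p, (2 / (d + 2) * (bernoulliVar g z + 2 * ε) + ε) := by
        refine setIntegral_mono_on (hIntOn _ (by fun_prop)) (hIntOn _ (by fun_prop)) hmS
          fun z hz => ?_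
        have := (h.abs_bernoulliVar_sub_le (p 0) z).trans
          (hδ _ (hpC 0) _ (hSC z hz) (by rw [dist_comm]; exact hzk z hz 0))
        have h2 : W + ε ≤ bernoulliVar g z + 2 * ε := by linarith [(abs_le.1 this).2]
        have h3 : (0 : ℝ) ≤ 2 / (d + 2) := by positivity
        linarith [mul_le_mul_of_nonneg_left h2 h3]

lemma volume_ne_zero_of_interior_nonempty (hCint : (interior C).Nonempty) : volume C ≠ 0 :=
  (Measure.measure_pos_of_nonempty_interior _ hCint).ne'

lemma isProbabilityMeasure_cond_volume (hCc : IsCompact C) (hCint : (interior C).Nonempty) :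
    IsProbabilityMeasure (cond volume C) :=
  cond_isProbabilityMeasure_of_finite (volume_ne_zero_of_interior_nonempty hCint)
    hCc.measure_lt_top.ne

lemma pi_cond_volume_absolutelyContinuous (hCc : IsCompact C) (hCint : (interior C).Nonempty)
    (n : ℕ) : (Measure.pi fun _ : Fin n => cond volume C) ≪ volume := by
  have := isProbabilityMeasure_cond_volume hCc hCint
  have h : (Measure.pi fun _ : Fin n => cond volume C)
      = ((volume C)⁻¹ ^ n) • (volume.restrict (Set.univ.pi fun _ : Fin n => C)) := by
    refine Measure.pi_eq fun s hs => ?_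
    rw [Measure.smul_apply, Measure.restrict_apply (MeasurableSet.univ_pi hs), ← Set.pi_inter_distrib,
      volume_pi, Measure.pi_pi, smul_eq_mul]
    simp only [cond_apply hCc.measurableSet, Finset.prod_mul_distrib, Finset.prod_const,
      Finset.card_univ, Fintype.card_fin, Set.inter_comm C]
  rw [h]
  exact (Measure.absolutelyContinuous_of_le Measure.restrict_le_self).smul_left _

/-- The points of a data set. -/
def design {n : ℕ} (D : Fin n → Pt d × ℝ) : Fin n → Pt d := fun i => (D i).1

/-- The labels of a data set. -/
def labels {n : ℕ} (D : Fin n → Pt d × ℝ) : Fin n → ℝ := fun i => label (D i)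

lemma measurable_design {n : ℕ} : Measurable (design (d := d) (n := n)) := by
  unfold design; fun_prop

lemma measurable_labels {n : ℕ} : Measurable (labels (d := d) (n := n)) :=
  measurable_pi_iff.2 fun i => measurable_label.comp (measurable_pi_apply i)

variable [IsProbabilityMeasure ν]

lemma map_design (hν : ν.map Prod.fst = cond volume C) (n : ℕ) :
    (Measure.pi fun _ : Fin n => ν).map design = Measure.pi fun _ : Fin n => cond volume C := by
  have : ∀ _ : Fin n, SigmaFinite (ν.map (Prod.fst : Pt d × ℝ → Pt d)) := fun _ =>
    have := Measure.isProbabilityMeasure_map (μ := ν) (f := (Prod.fst : Pt d × ℝ → Pt d))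
      measurable_fst.aemeasurable
    inferInstance
  rw [← hν]
  exact Measure.pi_map_pi (μ := fun _ : Fin n => ν) (f := fun _ => Prod.fst)
    fun _ => measurable_fst.aemeasurable

lemma ae_genPos_design (hd : 1 ≤ d) (hCc : IsCompact C) (hCint : (interior C).Nonempty)
    (hν : ν.map Prod.fst = cond volume C) (n : ℕ) :
    ∀ᵐ D ∂(Measure.pi fun _ : Fin n => ν), GenPos (design D) := by
  refine ae_of_ae_map measurable_design.aemeasurable ?_
  rw [map_design hν]
  exact (pi_cond_volume_absolutelyContinuous hCc hCint n).ae_le (ae_genPos hd n)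

lemma ae_mem_cond (hCc : IsCompact C) : ∀ᵐ z ∂(cond volume C), z ∈ C :=
  ae_cond_mem hCc.measurableSet

lemma ae_design_mem (hCc : IsCompact C) (hν : ν.map Prod.fst = cond volume C) (n : ℕ) :
    ∀ᵐ D ∂(Measure.pi fun _ : Fin n => ν), ∀ i, design D i ∈ C := by
  refine ae_pi_of_ae (p := fun q => q.1 ∈ C) ?_
  refine ae_of_ae_map measurable_fst.aemeasurable ?_
  rw [hν]
  exact ae_mem_cond hCc

lemma setIntegral_cond_volume_eq {S : Set (Pt d)} (hS : MeasurableSet S) (hSC : S ⊆ C)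
    (f : Pt d → ℝ) :
    ∫ z in S, f z ∂(cond volume C) = ((volume C)⁻¹).toReal * ∫ z in S, f z := by
  rw [ProbabilityTheory.cond, Measure.restrict_smul, Measure.restrict_restrict hS, Set.inter_eq_left.2 hSC,
    integral_smul_measure, smul_eq_mul]

end SimplicialRisk

end

/-! ### The mean squared error of interpolation. -/

noncomputable section

open scoped Topology ENNReal

namespace SimplicialRisk

variable {d : ℕ} {C : Set (Pt d)}

open Classical in
/-- The barycentric coordinates on a small cell, extended by zero. -/
def cellWeight {n : ℕ} (δ : ℝ) (s : Idx d n) (k : Fin (d + 1)) (q : (Fin n → Pt d) × Pt d) : ℝ :=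
  if q ∈ smallCell δ s then bary (verts q.1 s) q.2 k else 0

open Classical in
/-- The error of the linear interpolation of `g` on a small cell, extended by zero. -/
def cellBias {n : ℕ} (g : Pt d → ℝ) (δ : ℝ) (s : Idx d n) (q : (Fin n → Pt d) × Pt d) : ℝ :=
  if q ∈ smallCell δ s then ∑ k, bary (verts q.1 s) q.2 k * g (verts q.1 s k) - g q.2 else 0

/-- The error of the linear interpolation of the labels on a small cell, extended by zero. -/
def cellError {n : ℕ} (g : Pt d → ℝ) (δ : ℝ) (s : Idx d n) (D : Fin n → Pt d × ℝ) (z : Pt d) : ℝ :=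
  ∑ k, cellWeight δ s k (design D, z) * (label (D (enum s k)) - g (D (enum s k)).1)
    + cellBias g δ s (design D, z)

lemma cellError_of_mem {n : ℕ} {g : Pt d → ℝ} {δ : ℝ} {s : Idx d n} {D : Fin n → Pt d × ℝ}
    {z : Pt d} (h : (design D, z) ∈ smallCell δ s) :
    cellError g δ s D z
      = ∑ k, bary (verts (design D) s) z k * labels D (enum s k) - g z := by
  simp only [cellError, cellWeight, cellBias, if_pos h, mul_sub, Finset.sum_sub_distrib]
  simp only [labels, verts, design]
  ring

lemma cellError_of_notMem {n : ℕ} {g : Pt d → ℝ} {δ : ℝ} {s : Idx d n} {D : Fin n → Pt d × ℝ}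
    {z : Pt d} (h : (design D, z) ∉ smallCell δ s) : cellError g δ s D z = 0 := by
  simp [cellError, cellWeight, cellBias, h]

lemma measurable_cellWeight {n : ℕ} (δ : ℝ) (s : Idx d n) (k : Fin (d + 1)) :
    Measurable (cellWeight δ s k) := by
  classical
  exact Measurable.ite (measurableSet_smallCell δ s) (measurable_bary_verts s k) measurable_const

lemma abs_cellWeight_le {n : ℕ} (δ : ℝ) (s : Idx d n) (k : Fin (d + 1))
    (q : (Fin n → Pt d) × Pt d) : |cellWeight δ s k q| ≤ 1 := by
  unfold cellWeight
  split_ifs with h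
  · have hq := h.1.2.1
    rw [abs_of_pos (hq k), ← sum_bary h.1.1 q.2]
    exact Finset.single_le_sum (fun l _ => (hq l).le) (Finset.mem_univ k)
  · simp

variable {ν : Measure (Pt d × ℝ)} {g : Pt d → ℝ}

lemma IsRegression.measurable_cellBias (h : IsRegression ν g) {n : ℕ} (δ : ℝ) (s : Idx d n) :
    Measurable (cellBias g δ s) := by
  classical
  refine Measurable.ite (measurableSet_smallCell δ s) ?_ measurable_const
  refine (Finset.measurable_sum _ fun k _ => (measurable_bary_verts s k).mul ?_).sub
    (h.continuous.measurable.comp measurable_snd)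
  exact h.continuous.measurable.comp ((measurable_pi_apply _).comp measurable_fst)

lemma IsRegression.abs_cellBias_le (h : IsRegression ν g) {n : ℕ} (δ : ℝ) (s : Idx d n)
    (q : (Fin n → Pt d) × Pt d) : |cellBias g δ s q| ≤ 1 := by
  unfold cellBias
  split_ifs with hq
  · have hg := h.mem_Icc q.2
    have h0 : 0 ≤ ∑ k, bary (verts q.1 s) q.2 k * g (verts q.1 s k) :=
      Finset.sum_nonneg fun k _ => mul_nonneg (hq.1.2.1 k).le (h.mem_Icc _).1
    have h1 : ∑ k, bary (verts q.1 s) q.2 k * g (verts q.1 s k) ≤ 1 := by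
      rw [← sum_bary hq.1.1 q.2]
      exact Finset.sum_le_sum fun k _ => mul_le_of_le_one_right (hq.1.2.1 k).le (h.mem_Icc _).2
    rw [abs_le]
    constructor <;> linarith [hg.1, hg.2]
  · simp

lemma IsRegression.measurable_cellError (h : IsRegression ν g) {n : ℕ} (δ : ℝ) (s : Idx d n) :
    Measurable fun q : (Fin n → Pt d × ℝ) × Pt d => cellError g δ s q.1 q.2 := by
  have hm : Measurable fun q : (Fin n → Pt d × ℝ) × Pt d => (design q.1, q.2) :=
    (measurable_design.comp measurable_fst).prodMk measurable_snd
  refine (Finset.measurable_sum _ fun k _ => ?_).add ((h.measurable_cellBias δ s).comp hm)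
  refine ((measurable_cellWeight δ s k).comp hm).mul ?_
  exact h.measurable_noise.comp ((measurable_pi_apply _).comp measurable_fst)

lemma IsRegression.abs_cellError_le (h : IsRegression ν g) {n : ℕ} (δ : ℝ) (s : Idx d n)
    (D : Fin n → Pt d × ℝ) (z : Pt d) : |cellError g δ s D z| ≤ 1 := by
  by_cases hq : (design D, z) ∈ smallCell δ s
  · rw [cellError_of_mem hq]
    have hg := h.mem_Icc z
    have h0 : 0 ≤ ∑ k, bary (verts (design D) s) z k * labels D (enum s k) :=
      Finset.sum_nonneg fun k _ => mul_nonneg (hq.1.2.1 k).le (label_mem_Icc _).1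
    have h1 : ∑ k, bary (verts (design D) s) z k * labels D (enum s k) ≤ 1 := by
      rw [← sum_bary hq.1.1 z]
      exact Finset.sum_le_sum fun k _ => mul_le_of_le_one_right (hq.1.2.1 k).le (label_mem_Icc _).2
    rw [abs_le]
    constructor <;> linarith [hg.1, hg.2]
  · rw [cellError_of_notMem hq]; simp

/-- The pairs of a configuration and a point which lies in no small cell. -/
def badSet (d n : ℕ) (δ : ℝ) : Set ((Fin n → Pt d) × Pt d) := (⋃ s : Idx d n, smallCell δ s)ᶜ

lemma measurableSet_badSet (n : ℕ) (δ : ℝ) : MeasurableSet (badSet d n δ) :=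
  (MeasurableSet.iUnion fun s => measurableSet_smallCell δ s).compl

/-- Summing over all index sets replaces the random cell containing `z` by fixed sets of examples,
to which the bias-variance identity applies. Off the small cells the trivial bound `1` is used. -/
lemma IsRegression.sq_interp_sub_le (h : IsRegression ν g) {n : ℕ} (δ : ℝ)
    {D : Fin n → Pt d × ℝ} (hD : GenPos (design D)) (z : Pt d) :
    (interp (design D) (labels D) z - g z) ^ 2
      ≤ (badSet d n δ).indicator 1 (design D, z) + ∑ s : Idx d n, cellError g δ s D z ^ 2 := by
  by_cases hb : (design D, z) ∈ badSet d n δ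
  · have h1 := hD.interp_mem_Icc (fun i => label_mem_Icc (D i)) z
    have hg := h.mem_Icc z
    have h2 : (interp (design D) (labels D) z - g z) ^ 2 ≤ 1 := by
      rw [sq_le_one_iff_abs_le_one, abs_le]
      constructor <;> linarith [h1.1, h1.2, hg.1, hg.2, show interp (design D) (labels D) z
        = interp (design D) (fun i => label (D i)) z from rfl]
    rw [Set.indicator_of_mem hb]
    exact h2.trans (le_add_of_nonneg_right (Finset.sum_nonneg fun s _ => sq_nonneg _))
  · rw [Set.indicator_of_notMem hb, zero_add]
    obtain ⟨s, hs⟩ : ∃ s, (design D, z) ∈ smallCell δ s := by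
      simpa [badSet] using hb
    rw [hD.interp_eq hs.1, ← cellError_of_mem hs]
    exact Finset.single_le_sum (f := fun s => cellError g δ s D z ^ 2)
      (fun s _ => sq_nonneg _) (Finset.mem_univ s)

/-- The conditional mean squared error over a cell, given the points. -/
lemma IsRegression.integral_cell_le (h : IsRegression ν g) (hCconv : Convex ℝ C) {δ ε : ℝ}
    (hε1 : ε ≤ 1) (hδ : ∀ u ∈ C, ∀ v ∈ C, dist u v ≤ δ → |g u - g v| ≤ ε) {n : ℕ}
    {x : Fin n → Pt d} (hxC : ∀ i, x i ∈ C) (s : Idx d n) :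
    ∫ z, (∑ k, cellWeight δ s k (x, z) ^ 2 * bernoulliVar g (verts x s k)
        + cellBias g δ s (x, z) ^ 2) ∂(ProbabilityTheory.cond volume C)
      ≤ ∫ z, (smallCell δ s).indicator
          (fun q => 2 / (d + 2) * (bernoulliVar g q.2 + 2 * ε) + ε) (x, z)
          ∂(ProbabilityTheory.cond volume C) := by
  -- For a fixed configuration the set of `z` in the small cell is the whole open simplex or empty,
  -- according to these conditions, which do not involve `z`.
  by_cases hK : (vertexMatrix (verts x s)).det ≠ 0 ∧
      (∀ j, lift (verts x s) (x j) ≤ ‖x j‖ ^ 2) ∧ Small δ x s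
  · obtain ⟨hdet, hl, hsm⟩ := hK
    have hiff : ∀ z, (x, z) ∈ smallCell δ s ↔ z ∈ openSimplex (verts x s) := fun z =>
      ⟨fun hz => hz.1.2.1, fun hz => ⟨⟨hdet, hz, hl⟩, hsm⟩⟩
    have hmS := measurableSet_openSimplex hdet
    have hSC : openSimplex (verts x s) ⊆ C := (openSimplex_subset_convexHull hdet).trans
      (convexHull_min (by rintro _ ⟨k, rfl⟩; exact hxC _) hCconv)
    have h1 : ∀ z, ∑ k, cellWeight δ s k (x, z) ^ 2 * bernoulliVar g (verts x s k)
        + cellBias g δ s (x, z) ^ 2 = (openSimplex (verts x s)).indicator (fun z =>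
          ∑ k, bary (verts x s) z k ^ 2 * bernoulliVar g (verts x s k)
          + (∑ k, bary (verts x s) z k * g (verts x s k) - g z) ^ 2) z := fun z => by
      by_cases hz : z ∈ openSimplex (verts x s)
      · simp [Set.indicator_of_mem hz, cellWeight, cellBias, (hiff z).2 hz]
      · simp [Set.indicator_of_notMem hz, cellWeight, cellBias, mt (hiff z).1 hz]
    have h2 : ∀ z, (smallCell δ s).indicator
          (fun q => 2 / (d + 2) * (bernoulliVar g q.2 + 2 * ε) + ε) (x, z)
        = (openSimplex (verts x s)).indicator (fun z =>
          2 / (d + 2) * (bernoulliVar g z + 2 * ε) + ε) z := fun z => by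
      by_cases hz : z ∈ openSimplex (verts x s)
      · rw [Set.indicator_of_mem hz, Set.indicator_of_mem ((hiff z).2 hz)]
      · rw [Set.indicator_of_notMem hz, Set.indicator_of_notMem (mt (hiff z).1 hz)]
    simp only [h1, h2]
    rw [integral_indicator hmS, integral_indicator hmS, setIntegral_cond_volume_eq hmS hSC,
      setIntegral_cond_volume_eq hmS hSC]
    exact mul_le_mul_of_nonneg_left
      (h.setIntegral_openSimplex_le hCconv hdet (fun k => hxC _) hsm hε1 hδ) ENNReal.toReal_nonneg
  · have hne : ∀ z, (x, z) ∉ smallCell δ s := fun z hz => hK ⟨hz.1.1, hz.1.2.2, hz.2⟩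
    simp [cellWeight, cellBias, hne]

variable [IsProbabilityMeasure ν]

lemma IsRegression.integral_sq_cellError (h : IsRegression ν g) {n : ℕ} (δ : ℝ) (s : Idx d n)
    (z : Pt d) :
    ∫ D, cellError g δ s D z ^ 2 ∂(Measure.pi fun _ : Fin n => ν)
      = ∫ D, (∑ k, cellWeight δ s k (design D, z) ^ 2 * bernoulliVar g (verts (design D) s k)
        + cellBias g δ s (design D, z) ^ 2) ∂(Measure.pi fun _ : Fin n => ν) :=
  h.integral_sq_sum_noise (enum_injective s) (c := fun k x => cellWeight δ s k (x, z))
    (b := fun x => cellBias g δ s (x, z))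
    (fun k => (measurable_cellWeight δ s k).comp measurable_prodMk_right)
    ((h.measurable_cellBias δ s).comp measurable_prodMk_right)
    (fun k x => abs_cellWeight_le δ s k (x, z)) (fun x => h.abs_cellBias_le δ s (x, z))

/-- The mean squared error of simplicial interpolation. -/
lemma IsRegression.mse_le (h : IsRegression ν g) (hd : 1 ≤ d) (hCc : IsCompact C)
    (hCconv : Convex ℝ C) (hCint : (interior C).Nonempty)
    (hν : ν.map Prod.fst = ProbabilityTheory.cond volume C) {δ ε : ℝ} (hε0 : 0 ≤ ε) (hε1 : ε ≤ 1)
    (hδ : ∀ u ∈ C, ∀ v ∈ C, dist u v ≤ δ → |g u - g v| ≤ ε) (n : ℕ) :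
    ∫ q, (interp (design q.1) (labels q.1) q.2 - g q.2) ^ 2
        ∂((Measure.pi fun _ : Fin n => ν).prod (ProbabilityTheory.cond volume C))
      ≤ ((Measure.pi fun _ : Fin n => ν).prod (ProbabilityTheory.cond volume C)).real
          {q | (design q.1, q.2) ∈ badSet d n δ}
        + (2 / (d + 2) * (∫ z, bernoulliVar g z ∂(ProbabilityTheory.cond volume C) + 2 * ε) + ε) := by
  have := isProbabilityMeasure_cond_volume hCc hCint
  set μ := ProbabilityTheory.cond (volume : Measure (Pt d)) C with hμ
  set Q := Measure.pi fun _ : Fin n => ν with hQ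
  have hm : Measurable fun q : (Fin n → Pt d × ℝ) × Pt d => (design q.1, q.2) :=
    (measurable_design.comp measurable_fst).prodMk measurable_snd
  have hgen : ∀ᵐ q ∂(Q.prod μ), GenPos (design q.1) :=
    Measure.quasiMeasurePreserving_fst.ae (ae_genPos_design hd hCc hCint hν n)
  have hbm : MeasurableSet {q : (Fin n → Pt d × ℝ) × Pt d | (design q.1, q.2) ∈ badSet d n δ} :=
    (measurableSet_badSet n δ).preimage hm
  have hbi : ∀ q : (Fin n → Pt d × ℝ) × Pt d, (badSet d n δ).indicator (1 : (Fin n → Pt d) × Pt d → ℝ) (design q.1, q.2)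
      = {q : (Fin n → Pt d × ℝ) × Pt d | (design q.1, q.2) ∈ badSet d n δ}.indicator 1 q :=
    fun q => rfl
  have hbint : Integrable (fun q : (Fin n → Pt d × ℝ) × Pt d =>
      (badSet d n δ).indicator (1 : (Fin n → Pt d) × Pt d → ℝ) (design q.1, q.2)) (Q.prod μ) := by
    simp only [hbi]
    exact (integrable_const (1 : ℝ)).indicator hbm
  have hci : ∀ s : Idx d n, Integrable (fun q : (Fin n → Pt d × ℝ) × Pt d =>
      cellError g δ s q.1 q.2 ^ 2) (Q.prod μ) := fun s =>
    integrable_of_abs_le (B := 1) ((h.measurable_cellError δ s).pow_const 2) fun q => by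
      rw [abs_pow]; exact pow_le_one₀ (abs_nonneg _) (h.abs_cellError_le δ s _ _)
  have hwm := h.continuous_bernoulliVar.measurable
  set H : Pt d → ℝ := fun z => 2 / (d + 2) * (bernoulliVar g z + 2 * ε) + ε with hH
  have hHm : Measurable H := ((hwm.add_const _).const_mul _).add_const _
  have hH0 : ∀ z, 0 ≤ H z := fun z => by
    have := (h.bernoulliVar_mem_Icc z).1
    positivity
  have hH5 : ∀ z, |H z| ≤ 2 / (d + 2) * (1 + 2 * ε) + ε := fun z => by
    rw [abs_of_nonneg (hH0 z)]
    have := (h.bernoulliVar_mem_Icc z).2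
    simp only [hH]
    gcongr
  have hsi : ∀ s : Idx d n, Integrable (fun q : (Fin n → Pt d × ℝ) × Pt d =>
      (smallCell δ s).indicator (fun q => H q.2) (design q.1, q.2)) (Q.prod μ) := fun s => by
    refine integrable_of_abs_le (B := 2 / (d + 2) * (1 + 2 * ε) + ε)
      (((hHm.comp measurable_snd).indicator (measurableSet_smallCell δ s)).comp hm) fun q => ?_
    refine le_trans ?_ (hH5 q.2)
    by_cases hq : (design q.1, q.2) ∈ smallCell δ s
    · rw [Set.indicator_of_mem hq]
    · rw [Set.indicator_of_notMem hq]; simp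
  have hcell : ∀ s : Idx d n, ∫ q, cellError g δ s q.1 q.2 ^ 2 ∂(Q.prod μ)
      ≤ ∫ q, (smallCell δ s).indicator (fun q => H q.2) (design q.1, q.2) ∂(Q.prod μ) := by
    intro s
    have hvi : Integrable (fun q : (Fin n → Pt d × ℝ) × Pt d =>
        ∑ k, cellWeight δ s k (design q.1, q.2) ^ 2 * bernoulliVar g (verts (design q.1) s k)
          + cellBias g δ s (design q.1, q.2) ^ 2) (Q.prod μ) := by
      refine integrable_of_abs_le (B := ∑ _k : Fin (d + 1), (1 : ℝ) + 1) ?_ fun q => ?_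
      · refine (Finset.measurable_sum _ fun k _ => ?_).add
          (((h.measurable_cellBias δ s).comp hm).pow_const 2)
        refine (((measurable_cellWeight δ s k).comp hm).pow_const 2).mul (hwm.comp ?_)
        exact (measurable_pi_apply _).comp (measurable_design.comp measurable_fst)
      · refine (abs_add_le _ _).trans (add_le_add ((Finset.abs_sum_le_sum_abs _ _).trans
          (Finset.sum_le_sum fun k _ => ?_)) ?_)
        · have hw := h.bernoulliVar_mem_Icc (verts (design q.1) s k)
          rw [abs_mul, abs_pow, abs_of_nonneg hw.1]
          exact mul_le_one₀ (pow_le_one₀ (abs_nonneg _) (abs_cellWeight_le _ _ _ _)) hw.1 hw.2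
        · rw [abs_pow]; exact pow_le_one₀ (abs_nonneg _) (h.abs_cellBias_le _ _ _)
    -- Two orders of integration are needed: the labels are averaged out at fixed `z`, then `z` is
    -- averaged over the simplex at fixed points.
    calc ∫ q, cellError g δ s q.1 q.2 ^ 2 ∂(Q.prod μ)
        = ∫ z, ∫ D, cellError g δ s D z ^ 2 ∂Q ∂μ := integral_prod_symm _ (hci s)
      _ = ∫ z, ∫ D, (∑ k, cellWeight δ s k (design D, z) ^ 2
            * bernoulliVar g (verts (design D) s k) + cellBias g δ s (design D, z) ^ 2) ∂Q ∂μ := by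
          simp only [hQ, h.integral_sq_cellError]
      _ = ∫ D, ∫ z, (∑ k, cellWeight δ s k (design D, z) ^ 2
            * bernoulliVar g (verts (design D) s k) + cellBias g δ s (design D, z) ^ 2) ∂μ ∂Q := by
          rw [← integral_prod_symm _ hvi, integral_prod _ hvi]
      _ ≤ ∫ D, ∫ z, (smallCell δ s).indicator (fun q => H q.2) (design D, z) ∂μ ∂Q := by
          refine integral_mono_ae hvi.integral_prod_left (hsi s).integral_prod_left ?_
          filter_upwards [ae_design_mem hCc hν n] with D hD
          exact h.integral_cell_le hCconv hε1 hδ hD s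
      _ = _ := (integral_prod _ (hsi s)).symm
  -- In general position the cells are disjoint, so at most one indicator is nonzero.
  have hsum : ∫ q, ∑ s : Idx d n, (smallCell δ s).indicator (fun q => H q.2) (design q.1, q.2)
      ∂(Q.prod μ) ≤ ∫ q, H q.2 ∂(Q.prod μ) := by
    refine integral_mono_ae (integrable_finsetSum _ fun s _ => hsi s)
      (integrable_of_abs_le (hHm.comp measurable_snd) fun q => hH5 q.2) ?_
    filter_upwards [hgen] with q hq
    by_cases hex : ∃ s, (design q.1, q.2) ∈ smallCell δ s
    · obtain ⟨s, hs⟩ := hex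
      rw [Finset.sum_eq_single s, Set.indicator_of_mem hs]
      · intro t _ hts
        rw [Set.indicator_of_notMem fun ht => hts (hq.cell_unique ht.1 hs.1)]
      · simp
    · push Not at hex
      rw [Finset.sum_eq_zero fun s _ => Set.indicator_of_notMem (hex s) _]
      exact hH0 _
  have hHint : ∫ q, H q.2 ∂(Q.prod μ)
      = 2 / (d + 2) * (∫ z, bernoulliVar g z ∂μ + 2 * ε) + ε := by
    have hwi : Integrable (bernoulliVar g) μ := integrable_of_abs_le (B := 1) hwm fun z => by
      rw [abs_of_nonneg (h.bernoulliVar_mem_Icc z).1]; exact (h.bernoulliVar_mem_Icc z).2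
    have hwi2 : Integrable (fun z => bernoulliVar g z + 2 * ε) μ := hwi.add (integrable_const _)
    rw [integral_fun_snd]
    simp only [hH]
    rw [integral_add (hwi2.const_mul _) (integrable_const _),
      integral_const_mul, integral_add hwi (integrable_const _)]
    simp
  calc _ ≤ ∫ q, ((badSet d n δ).indicator 1 (design q.1, q.2)
          + ∑ s : Idx d n, cellError g δ s q.1 q.2 ^ 2) ∂(Q.prod μ) := by
        refine integral_mono_of_nonneg (Eventually.of_forall fun q => sq_nonneg _)
          (hbint.add (integrable_finsetSum _ fun s _ => hci s)) ?_
        filter_upwards [hgen] with q hq using h.sq_interp_sub_le δ hq q.2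
    _ = ∫ q, (badSet d n δ).indicator 1 (design q.1, q.2) ∂(Q.prod μ)
          + ∑ s : Idx d n, ∫ q, cellError g δ s q.1 q.2 ^ 2 ∂(Q.prod μ) := by
        rw [integral_add hbint (integrable_finsetSum _ fun s _ => hci s),
          integral_finsetSum _ fun s _ => hci s]
    _ ≤ _ := by
        refine add_le_add ?_ ?_
        · simp only [hbi]
          rw [integral_indicator_one hbm]
        · rw [← hHint]
          refine le_trans (Finset.sum_le_sum fun s _ => hcell s) ?_
          rw [← integral_finsetSum _ fun s _ => hsi s]
          exact hsum

end SimplicialRisk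

end

/-! ### Small cells cover with probability tending to one. -/

noncomputable section

open scoped Topology ENNReal

namespace SimplicialRisk

variable {d : ℕ} {C : Set (Pt d)} {ν : Measure (Pt d × ℝ)}

lemma measurableSet_offFacets (d n : ℕ) :
    MeasurableSet {q : (Fin n → Pt d) × Pt d | OffFacets q.1 q.2} := by
  unfold OffFacets
  rw [Set.ofPred_forall]
  refine MeasurableSet.iInter fun s => ?_
  rw [Set.ofPred_forall]
  exact MeasurableSet.iInter fun k =>
    (measurableSet_eq_fun (measurable_bary_verts s k) measurable_const).compl

lemma cond_volume_absolutelyContinuous : ProbabilityTheory.cond volume C ≪ volume :=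
  cond_absolutelyContinuous

lemma ae_mem_interior (hCc : IsCompact C) (hCconv : Convex ℝ C) :
    ∀ᵐ z ∂(ProbabilityTheory.cond volume C), z ∈ interior C := by
  have h1 : ∀ᵐ z ∂(ProbabilityTheory.cond volume C), z ∉ frontier C :=
    cond_volume_absolutelyContinuous.ae_le
      (measure_eq_zero_iff_ae_notMem.1 (hCconv.addHaar_frontier volume))
  filter_upwards [h1, ae_mem_cond hCc] with z hz hzC
  by_contra h
  exact hz (by rw [hCc.isClosed.frontier_eq]; exact ⟨hzC, h⟩)

/-- Up to null sets, if `z` is in no small cell then some net ball contains no sample point, an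
event of probability `μ(complement) ^ n` by independence; the rest is a union bound. -/
lemma IsDelaunayScheme.measure_badSet_le {T : (n : ℕ) → (Fin n → Pt d) → Finset (Finset (Fin n))}
    (hT : IsDelaunayScheme T) {δ ρ : ℝ} (hρ : 0 < ρ) (hδ : 2 * ρ ≤ δ) {z : Pt d}
    {F : Finset (Pt d)} (hF : ∀ (n : ℕ) (x : Fin n → Pt d),
      (∀ q ∈ F, ∃ i, dist (x i) q < ρ / 2) → DenseNear x z ρ)
    (hν : ν.map Prod.fst = ProbabilityTheory.cond volume C) [IsProbabilityMeasure ν] {n : ℕ}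
    (hn : d < n) (hgen : ∀ᵐ D ∂(Measure.pi fun _ : Fin n => ν), GenPos (design D))
    (hoff : ∀ᵐ D ∂(Measure.pi fun _ : Fin n => ν), OffFacets (design D) z) :
    (Measure.pi fun _ : Fin n => ν) {D | (design D, z) ∈ badSet d n δ}
      ≤ ∑ q ∈ F, (ProbabilityTheory.cond volume C (Metric.ball q (ρ / 2))ᶜ) ^ n := by
  have hq : ∀ q, (Measure.pi fun _ : Fin n => ν) {D | ∀ i, ¬ dist (design D i) q < ρ / 2}
      = (ProbabilityTheory.cond volume C (Metric.ball q (ρ / 2))ᶜ) ^ n := fun q => by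
    have : {D : Fin n → Pt d × ℝ | ∀ i, ¬ dist (design D i) q < ρ / 2}
        = Set.univ.pi fun _ => Prod.fst ⁻¹' (Metric.ball q (ρ / 2))ᶜ := by
      ext D; simp [design]
    rw [this, Measure.pi_pi, Finset.prod_const, Finset.card_univ, Fintype.card_fin, ← hν,
      Measure.map_apply measurable_fst Metric.isOpen_ball.measurableSet.compl]
  calc _ ≤ (Measure.pi fun _ : Fin n => ν)
        (⋃ q ∈ F, {D | ∀ i, ¬ dist (design D i) q < ρ / 2}) := by
        refine measure_mono_ae ?_
        filter_upwards [hgen, hoff] with D hD hDz hbad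
        change D ∈ ⋃ q ∈ F, _
        by_contra hcon
        simp only [Set.mem_iUnion, not_exists, Set.mem_ofPred_eq, not_forall, not_not] at hcon
        obtain ⟨s, hs⟩ := (hT n _ (hD.affineSpan_eq_top hn)).exists_mem_smallCell hDz hρ
          (hF n _ fun q hq => by simpa using hcon q hq) hδ
        exact hbad (Set.mem_iUnion.2 ⟨s, hs⟩)
    _ ≤ ∑ q ∈ F, (Measure.pi fun _ : Fin n => ν) {D | ∀ i, ¬ dist (design D i) q < ρ / 2} :=
        measure_biUnion_finset_le _ _
    _ = _ := Finset.sum_congr rfl fun q _ => hq q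

lemma cond_volume_compl_ball_lt_one (hCc : IsCompact C) (hCint : (interior C).Nonempty)
    {q : Pt d} {r : ℝ} (hr : 0 < r) (h : Metric.ball q r ⊆ C) :
    ProbabilityTheory.cond volume C (Metric.ball q r)ᶜ < 1 := by
  have := isProbabilityMeasure_cond_volume hCc hCint
  rw [prob_compl_eq_one_sub Metric.isOpen_ball.measurableSet]
  refine ENNReal.sub_lt_self ENNReal.one_ne_top one_ne_zero ?_
  rw [cond_apply hCc.measurableSet, Set.inter_eq_right.2 h]
  exact mul_ne_zero (ENNReal.inv_ne_zero.2 hCc.measure_lt_top.ne)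
    (Metric.measure_ball_pos volume q hr).ne'

/-- The probability that a random point lies in no small cell tends to zero. -/
lemma IsDelaunayScheme.tendsto_badSet [IsProbabilityMeasure ν]
    {T : (n : ℕ) → (Fin n → Pt d) → Finset (Finset (Fin n))}
    (hT : IsDelaunayScheme T) (hd : 1 ≤ d) (hCc : IsCompact C) (hCconv : Convex ℝ C)
    (hCint : (interior C).Nonempty) (hν : ν.map Prod.fst = ProbabilityTheory.cond volume C)
    {δ : ℝ} (hδ : 0 < δ) :
    Tendsto (fun n => ((Measure.pi fun _ : Fin n => ν).prod
      (ProbabilityTheory.cond volume C)).real {q | (design q.1, q.2) ∈ badSet d n δ})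
      atTop (𝓝 0) := by
  have := isProbabilityMeasure_cond_volume hCc hCint
  set μ := ProbabilityTheory.cond (volume : Measure (Pt d)) C with hμ
  have hm : ∀ n, Measurable fun q : (Fin n → Pt d × ℝ) × Pt d => (design q.1, q.2) := fun n =>
    (measurable_design.comp measurable_fst).prodMk measurable_snd
  have hbm : ∀ n, MeasurableSet
      {q : (Fin n → Pt d × ℝ) × Pt d | (design q.1, q.2) ∈ badSet d n δ} := fun n =>
    (measurableSet_badSet n δ).preimage (hm n)
  -- General position gives this for almost every `z` at fixed points; Fubini exchanges the
  -- quantifiers.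
  have hoff : ∀ᵐ z ∂μ, ∀ n, ∀ᵐ D ∂(Measure.pi fun _ : Fin n => ν), OffFacets (design D) z := by
    refine ae_all_iff.2 fun n => ?_
    have h1 : ∀ᵐ D ∂(Measure.pi fun _ : Fin n => ν), ∀ᵐ z ∂μ, OffFacets (design D) z := by
      filter_upwards [ae_genPos_design hd hCc hCint hν n] with D hD
      exact cond_volume_absolutelyContinuous.ae_le hD.ae_offFacets
    exact (Measure.ae_ae_comm (p := fun D z => OffFacets (design D) z)
      ((measurableSet_offFacets d n).preimage (hm n))).1 h1
  have hlim : Tendsto (fun n => ∫⁻ z, (Measure.pi fun _ : Fin n => ν)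
      {D | (design D, z) ∈ badSet d n δ} ∂μ) atTop (𝓝 (∫⁻ _, 0 ∂μ)) := by
    refine tendsto_lintegral_of_dominated_convergence (fun _ => 1)
      (fun n => measurable_measure_prodMk_right (hbm n))
      (fun n => Eventually.of_forall fun z => prob_le_one) (by simp) ?_
    filter_upwards [hoff, ae_mem_interior hCc hCconv] with z hz hzC
    obtain ⟨r, hr, hrC⟩ := Metric.isOpen_iff.1 isOpen_interior z hzC
    -- The bound `r / 2` keeps the net balls inside `C`, hence of positive mass; `δ / 2` makes the
    -- cell diameter at most `δ`.
    have hρ : 0 < min (r / 2) (δ / 2) := lt_min (by linarith) (by linarith)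
    set ρ := min (r / 2) (δ / 2) with hρd
    have h1 : 2 * ρ ≤ r := by linarith [min_le_left (r / 2) (δ / 2)]
    have h2 : 2 * ρ ≤ δ := by linarith [min_le_right (r / 2) (δ / 2)]
    obtain ⟨F, hF1, hF2⟩ := exists_finite_net_denseNear z hρ
    refine tendsto_of_tendsto_of_tendsto_of_le_of_le' tendsto_const_nhds
      (h := fun n => ∑ q ∈ F, (μ (Metric.ball q (ρ / 2))ᶜ) ^ n) ?_
      (Eventually.of_forall fun n => zero_le) ?_
    · have hzero : (0 : ℝ≥0∞) = ∑ _q ∈ F, 0 := by simp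
      rw [hzero]
      refine tendsto_finsetSum _ fun q hq => ENNReal.tendsto_pow_atTop_nhds_zero_of_lt_one ?_
      refine cond_volume_compl_ball_lt_one hCc hCint (half_pos hρ) fun u hu => ?_
      refine interior_subset (hrC (Metric.mem_ball.2 ?_))
      have := dist_triangle u q z
      linarith [Metric.mem_ball.1 hu, hF1 q hq]
    · filter_upwards [eventually_gt_atTop d] with n hn
      exact hT.measure_badSet_le hρ h2 hF2 hν hn (ae_genPos_design hd hCc hCint hν n) (hz n)
  rw [lintegral_zero] at hlim
  have := (ENNReal.tendsto_toReal ENNReal.zero_ne_top).comp hlim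
  refine this.congr fun n => ?_
  rw [measureReal_def, Measure.prod_apply_symm (hbm n)]
  rfl

end SimplicialRisk

end

/-! ### The regression function of the model; risk in terms of it. -/

noncomputable section

open scoped Topology ENNReal

namespace SimplicialRisk

variable {d : ℕ} {C : Set (Pt d)}

lemma IsSmoothOnSupport.continuousOn {μ : Measure (Pt d)} {η : Pt d → ℝ} {A α : ℝ} (hα : 0 < α)
    (h : IsSmoothOnSupport μ η A α) : ContinuousOn η μ.support := by
  intro x hx
  rw [ContinuousWithinAt, tendsto_iff_dist_tendsto_zero]
  have hlim : Tendsto (fun x' : Pt d => A * ‖x' - x‖ ^ α) (𝓝[μ.support] x) (𝓝 0) := by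
    have : ContinuousAt (fun x' : Pt d => A * ‖x' - x‖ ^ α) x :=
      continuousAt_const.mul
        (ContinuousAt.rpow_const (by fun_prop) (Or.inr hα.le))
    have h2 := this.tendsto.mono_left (nhdsWithin_le_nhds (s := μ.support))
    simpa [Real.zero_rpow hα.ne'] using h2
  refine squeeze_zero' (Eventually.of_forall fun _ => dist_nonneg) ?_ hlim
  filter_upwards [self_mem_nhdsWithin] with x' hx'
  rw [Real.dist_eq]
  exact h x' hx' x hx

/-- A continuous function on a closed set extends to a continuous function with values in the unit
interval which agrees with it where its values are in the unit interval. -/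
lemma exists_continuous_unitInterval_extension {S : Set (Pt d)} (hS : IsClosed S) {η : Pt d → ℝ}
    (hη : ContinuousOn η S) : ∃ g : Pt d → ℝ, Continuous g ∧ (∀ z, g z ∈ Set.Icc (0 : ℝ) 1) ∧
      ∀ z ∈ S, η z ∈ Set.Icc (0 : ℝ) 1 → g z = η z := by
  obtain ⟨G, hG⟩ := ContinuousMap.exists_restrict_eq hS ⟨S.domRestrict η, hη.domRestrict⟩
  refine ⟨fun z => max 0 (min 1 (G z)), by fun_prop,
    fun z => ⟨le_max_left _ _, max_le zero_le_one (min_le_left _ _)⟩, fun z hz h01 => ?_⟩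
  have : G z = η z := congrArg (fun f : C(S, ℝ) => f ⟨z, hz⟩) hG
  dsimp only
  rw [this, min_eq_right h01.2, max_eq_right h01.1]

section Model

variable {Ω : Type*} [MeasurableSpace Ω] {P : Measure Ω}

/-- Extend `η` from the support by Tietze and truncate to `[0, 1]`. Truncation changes nothing
almost surely at `X`, as `η (X ω)` is a conditional mean of a binary variable; `cond_mean` is the
pull-out property. -/
lemma exists_isRegression [IsProbabilityMeasure P] {X : Ω → Pt d} {Y : Ω → ℝ} (hX : Measurable X) (hY : Measurable Y)
    (hbinary : ∀ᵐ ω ∂P, Y ω = 0 ∨ Y ω = 1) {η : Pt d → ℝ}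
    (hη : (fun ω => η (X ω)) =ᵐ[P] P[Y | MeasurableSpace.comap X inferInstance])
    (hcont : ContinuousOn η (P.map X).support) :
    ∃ g : Pt d → ℝ, IsRegression (P.map fun ω => (X ω, Y ω)) g ∧ ∀ᵐ ω ∂P, g (X ω) = η (X ω) := by
  obtain ⟨g, hgc, hg01, hgη⟩ :=
    exists_continuous_unitInterval_extension Measure.isClosed_support hcont
  have hXY : Measurable fun ω => (X ω, Y ω) := hX.prodMk hY
  have hYint : Integrable Y P := by
    refine Integrable.of_bound hY.aestronglyMeasurable 1 ?_
    filter_upwards [hbinary] with ω hω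
    rcases hω with h | h <;> simp [h]
  have h0 : 0 ≤ᵐ[P] P[Y | MeasurableSpace.comap X inferInstance] := by
    refine condExp_nonneg ?_
    filter_upwards [hbinary] with ω hω
    rcases hω with h | h <;> simp [h]
  have h1 : P[Y | MeasurableSpace.comap X inferInstance] ≤ᵐ[P] fun _ => (1 : ℝ) := by
    have h2 := condExp_mono (m := MeasurableSpace.comap X inferInstance) hYint
      (integrable_const (1 : ℝ)) (by
        filter_upwards [hbinary] with ω hω
        rcases hω with h | h <;> simp [h])
    rwa [condExp_const hX.comap_le] at h2
  have hgX : ∀ᵐ ω ∂P, g (X ω) = η (X ω) := by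
    filter_upwards [h0, h1, hη, ae_of_ae_map hX.aemeasurable
      (Measure.support_mem_ae (μ := P.map X))] with ω h0 h1 h2 h3
    refine hgη _ h3 ⟨?_, ?_⟩
    · rw [h2]; exact h0
    · rw [h2]; exact h1
  have hbin : ∀ᵐ q ∂(P.map fun ω => (X ω, Y ω)), q.2 = 0 ∨ q.2 = 1 := by
    have hS : MeasurableSet {q : Pt d × ℝ | q.2 = 0 ∨ q.2 = 1} :=
      (measurableSet_eq_fun measurable_snd measurable_const).union
        (measurableSet_eq_fun measurable_snd measurable_const)
    rw [ae_map_iff hXY.aemeasurable hS]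
    exact hbinary
  refine ⟨g, ⟨hgc, hg01, hbin, fun ψ B hψ hB => ?_⟩, hgX⟩
  have hm : AEStronglyMeasurable (fun q : Pt d × ℝ => ψ q.1 * (label q - g q.1))
      (P.map fun ω => (X ω, Y ω)) :=
    ((hψ.comp measurable_fst).mul (measurable_label.sub
      (hgc.measurable.comp measurable_fst))).aestronglyMeasurable
  rw [integral_map hXY.aemeasurable hm]
  have hψY : Integrable (fun ω => ψ (X ω) * Y ω) P :=
    hYint.bdd_mul (hψ.comp hX).aestronglyMeasurable (Eventually.of_forall fun ω => hB (X ω))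
  have hψg : Integrable (fun ω => ψ (X ω) * g (X ω)) P := by
    refine integrable_of_abs_le (B := B * 1) ((hψ.comp hX).mul (hgc.measurable.comp hX)) fun ω => ?_
    rw [abs_mul]
    have hg := hg01 (X ω)
    refine mul_le_mul (hB _) ?_ (abs_nonneg _) ((abs_nonneg _).trans (hB (X ω)))
    rw [abs_of_nonneg hg.1]; exact hg.2
  have hpull := condExp_mul_of_stronglyMeasurable_left
    (m := MeasurableSpace.comap X inferInstance) (μ := P) (f := fun ω => ψ (X ω)) (g := Y)
    (hψ.comp (comap_measurable X)).stronglyMeasurable hψY hYint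
  have heq : ∫ ω, ψ (X ω) * g (X ω) ∂P = ∫ ω, ψ (X ω) * Y ω ∂P := by
    have h3 := integral_condExp (μ := P) (f := (fun ω => ψ (X ω)) * Y) hX.comap_le
    rw [show ∫ ω, ψ (X ω) * Y ω ∂P = ∫ ω, ((fun ω => ψ (X ω)) * Y) ω ∂P from rfl, ← h3]
    refine integral_congr_ae ?_
    filter_upwards [hpull, hη, hgX] with ω h4 h5 h6
    rw [h4, h6, h5]; rfl
  have hcongr : ∫ ω, ψ (X ω) * (label (X ω, Y ω) - g (X ω)) ∂P
      = ∫ ω, (ψ (X ω) * Y ω - ψ (X ω) * g (X ω)) ∂P := by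
    refine integral_congr_ae ?_
    filter_upwards [hbinary] with ω hω
    rw [label_eq (q := (X ω, Y ω)) hω, mul_sub]
  rw [hcongr, integral_sub hψY hψg, heq]
  exact sub_self _

lemma risk_congr {X : Ω → Pt d} (hX : Measurable X) (Y : Ω → ℝ) {f f' : Pt d → ℝ}
    (h : f =ᵐ[P.map X] f') : risk P X Y f = risk P X Y f' := by
  refine measureReal_congr ?_
  filter_upwards [ae_of_ae_map hX.aemeasurable h] with ω hω
  change (f (X ω) ≠ Y ω) = (f' (X ω) ≠ Y ω)
  rw [hω]

lemma measurable_plugIn {h : Pt d → ℝ} (hh : Measurable h) : Measurable (plugIn h) := by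
  classical
  exact Measurable.ite (measurableSet_lt measurable_const hh) measurable_const measurable_const

lemma plugIn_eq_zero_or_one (h : Pt d → ℝ) (z : Pt d) : plugIn h z = 0 ∨ plugIn h z = 1 := by
  unfold plugIn; split_ifs <;> simp

/-- The conditional risk at `z` of the plug-in classifier based on `h`. -/
def localRisk (g h : Pt d → ℝ) (z : Pt d) : ℝ := plugIn h z * (1 - 2 * g z) + g z

lemma IsRegression.localRisk_mem_Icc {ν : Measure (Pt d × ℝ)} {g : Pt d → ℝ}
    (hg : IsRegression ν g) (h : Pt d → ℝ) (z : Pt d) : localRisk g h z ∈ Set.Icc (0 : ℝ) 1 := by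
  have h1 := hg.mem_Icc z
  unfold localRisk
  rcases plugIn_eq_zero_or_one h z with h2 | h2 <;> rw [h2] <;>
    constructor <;> linarith [h1.1, h1.2]

/-- Where the two classifiers differ, the loss is `|1 - 2 * g z|` and `1 / 2` lies between `g z` and
`h z`. -/
lemma localRisk_sub_le (g h : Pt d → ℝ) (z : Pt d) :
    localRisk g h z - localRisk g g z ≤ 2 * |h z - g z| := by
  unfold localRisk plugIn
  have h1 := abs_le.1 (le_refl |h z - g z|)
  have h2 := abs_nonneg (h z - g z)
  split_ifs <;> linarith [h1.1, h1.2]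

/-- For a binary prediction `f` and label `y` the error indicator is `f + y - 2 * f * y`, that is
`localRisk` plus `1 - 2 * f` times the noise, and the latter has mean zero. -/
lemma IsRegression.risk_plugIn_eq [IsProbabilityMeasure P] {X : Ω → Pt d} {Y : Ω → ℝ} (hX : Measurable X)
    (hY : Measurable Y) {g h : Pt d → ℝ} (hg : IsRegression (P.map fun ω => (X ω, Y ω)) g)
    (hh : Measurable h) : risk P X Y (plugIn h) = ∫ z, localRisk g h z ∂(P.map X) := by
  have hXY : Measurable fun ω => (X ω, Y ω) := hX.prodMk hY
  have hprob := Measure.isProbabilityMeasure_map (μ := P) hXY.aemeasurable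
  set ν := P.map fun ω => (X ω, Y ω) with hν
  have hmap : ν.map Prod.fst = P.map X := by
    rw [hν, Measure.map_map measurable_fst hXY]; rfl
  have hpm := measurable_plugIn hh
  have hlm : Measurable (localRisk g h) :=
    (hpm.mul (measurable_const.sub (hg.continuous.measurable.const_mul 2))).add
      hg.continuous.measurable
  have hS : MeasurableSet {q : Pt d × ℝ | plugIn h q.1 ≠ q.2} :=
    (measurableSet_eq_fun (hpm.comp measurable_fst) measurable_snd).compl
  have hψ : ∀ z, |1 - 2 * plugIn h z| ≤ 1 := fun z => by
    rcases plugIn_eq_zero_or_one h z with h2 | h2 <;> rw [h2] <;> norm_num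
  have hae : {q : Pt d × ℝ | plugIn h q.1 ≠ q.2}.indicator (1 : Pt d × ℝ → ℝ)
      =ᵐ[ν] fun q => localRisk g h q.1 + (1 - 2 * plugIn h q.1) * (label q - g q.1) := by
    filter_upwards [hg.binary] with q hq
    rw [label_eq hq, Set.indicator_apply]
    simp only [Set.mem_ofPred_eq, localRisk, Pi.one_apply]
    rcases hq with hq | hq <;> rcases plugIn_eq_zero_or_one h q.1 with h2 | h2 <;>
      rw [hq, h2] <;> norm_num <;> ring
  have hloc : Integrable (fun q : Pt d × ℝ => localRisk g h q.1) ν :=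
    integrable_of_abs_le (B := 1) (hlm.comp measurable_fst) fun q => by
      have := hg.localRisk_mem_Icc h q.1
      rw [abs_of_nonneg this.1]; exact this.2
  have hnoise : Integrable (fun q : Pt d × ℝ => (1 - 2 * plugIn h q.1) * (label q - g q.1)) ν := by
    refine integrable_of_abs_le (B := 1) ?_ fun q => ?_
    · exact (measurable_const.sub ((hpm.comp measurable_fst).const_mul 2)).mul hg.measurable_noise
    · rw [abs_mul]; exact mul_le_one₀ (hψ _) (abs_nonneg _) (hg.abs_noise_le q)
  calc risk P X Y (plugIn h) = ν.real {q | plugIn h q.1 ≠ q.2} :=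
        (map_measureReal_apply hXY hS).symm
    _ = ∫ q, (localRisk g h q.1 + (1 - 2 * plugIn h q.1) * (label q - g q.1)) ∂ν := by
        rw [← integral_indicator_one hS, integral_congr_ae hae]
    _ = ∫ q, localRisk g h q.1 ∂ν := by
        rw [integral_add hloc hnoise, hg.cond_mean (fun z => 1 - 2 * plugIn h z) 1
          (measurable_const.sub (hpm.const_mul 2)) hψ, add_zero]
    _ = ∫ z, localRisk g h z ∂(P.map X) := by
        rw [← hmap, integral_map measurable_fst.aemeasurable hlm.aestronglyMeasurable]

lemma IsRegression.integral_noise_sq {ν : Measure (Pt d × ℝ)} [IsProbabilityMeasure ν]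
    {g : Pt d → ℝ} (hg : IsRegression ν g) :
    ∫ q, (label q - g q.1) ^ 2 ∂ν = ∫ z, bernoulliVar g z ∂(ν.map Prod.fst) := by
  have hψ : ∀ z, |1 - 2 * g z| ≤ 1 := fun z => by
    have := hg.mem_Icc z
    rw [abs_le]; constructor <;> linarith [this.1, this.2]
  have hψm : Measurable fun z => 1 - 2 * g z :=
    measurable_const.sub (hg.continuous.measurable.const_mul 2)
  have hwm := hg.continuous_bernoulliVar.measurable
  rw [integral_congr_ae hg.ae_noise_sq, integral_add, hg.cond_mean (fun z => 1 - 2 * g z) 1 hψm hψ,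
    zero_add, integral_map measurable_fst.aemeasurable hwm.aestronglyMeasurable]
  · rfl
  · refine integrable_of_abs_le (B := 1) ((hψm.comp measurable_fst).mul hg.measurable_noise)
      fun q => ?_
    rw [abs_mul]; exact mul_le_one₀ (hψ _) (abs_nonneg _) (hg.abs_noise_le q)
  · refine integrable_of_abs_le (B := 1) (hwm.comp measurable_fst) fun q => ?_
    have := hg.bernoulliVar_mem_Icc q.1
    change |bernoulliVar g q.1| ≤ 1
    rw [abs_of_nonneg this.1]; exact this.2

end Model

lemma integral_le_sqrt_integral_sq {Ω : Type*} [MeasurableSpace Ω] {P : Measure Ω}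
    [IsProbabilityMeasure P] {f : Ω → ℝ} (hf : Integrable f P)
    (hf2 : Integrable (fun ω => f ω ^ 2) P) : ∫ ω, f ω ∂P ≤ √(∫ ω, f ω ^ 2 ∂P) := by
  refine Real.le_sqrt_of_sq_le ?_
  set m := ∫ ω, f ω ∂P with hm
  have h : ∫ ω, (2 * m * f ω - m ^ 2) ∂P ≤ ∫ ω, f ω ^ 2 ∂P :=
    integral_mono ((hf.const_mul _).sub (integrable_const _)) hf2 fun ω => by
      have := sq_nonneg (f ω - m)
      dsimp only
      linarith
  rw [integral_sub (hf.const_mul _) (integrable_const _), integral_const_mul, ← hm] at h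
  simp only [integral_const, probReal_univ, one_smul] at h
  linarith

end SimplicialRisk

end

/-! ### From mean squared error to excess risk. -/

noncomputable section

open scoped Topology ENNReal

namespace SimplicialRisk

variable {d : ℕ} {C : Set (Pt d)} {ν : Measure (Pt d × ℝ)} {g : Pt d → ℝ}

lemma measurable_interp_data {n : ℕ} : Measurable fun q : (Fin n → Pt d × ℝ) × Pt d =>
    interp (design q.1) (labels q.1) q.2 := by
  have hm : Measurable fun q : (Fin n → Pt d × ℝ) × Pt d => ((design q.1, labels q.1), q.2) :=
    ((measurable_design.comp measurable_fst).prodMk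
      (measurable_labels.comp measurable_fst)).prodMk measurable_snd
  have h := measurable_interp.comp hm
  exact h

lemma measurable_interp_data_right {n : ℕ} (D : Fin n → Pt d × ℝ) :
    Measurable (interp (design D) (labels D)) := by
  have h := measurable_interp_data.comp (measurable_prodMk_left (x := D))
  exact h

lemma IsRegression.measurable_localRisk (h : IsRegression ν g) {n : ℕ} :
    Measurable fun q : (Fin n → Pt d × ℝ) × Pt d =>
      localRisk g (interp (design q.1) (labels q.1)) q.2 := by
  classical
  have hg : Measurable fun q : (Fin n → Pt d × ℝ) × Pt d => g q.2 :=
    h.continuous.measurable.comp measurable_snd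
  have hp : Measurable fun q : (Fin n → Pt d × ℝ) × Pt d =>
      plugIn (interp (design q.1) (labels q.1)) q.2 :=
    Measurable.ite (measurableSet_lt measurable_const measurable_interp_data) measurable_const
      measurable_const
  exact (hp.mul (measurable_const.sub (hg.const_mul 2))).add hg

lemma IsRegression.integrable_localRisk {μ : Measure (Pt d)} [IsFiniteMeasure μ]
    (hg : IsRegression ν g) {h : Pt d → ℝ} (hh : Measurable h) :
    Integrable (localRisk g h) μ := by
  refine integrable_of_abs_le (B := 1) (((measurable_plugIn hh).mul (measurable_const.sub
    (hg.continuous.measurable.const_mul 2))).add hg.continuous.measurable) fun z => ?_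
  have := hg.localRisk_mem_Icc h z
  change |localRisk g h z| ≤ 1
  rw [abs_of_nonneg this.1]; exact this.2

/-- The expected excess risk is at most twice the root mean squared error. -/
lemma IsRegression.integral_excess_le [IsProbabilityMeasure ν] (h : IsRegression ν g) (hd : 1 ≤ d)
    (hCc : IsCompact C) (hCint : (interior C).Nonempty)
    (hν : ν.map Prod.fst = ProbabilityTheory.cond volume C) (n : ℕ) :
    ∫ D, (∫ z, localRisk g (interp (design D) (labels D)) z ∂(ProbabilityTheory.cond volume C)
        - ∫ z, localRisk g g z ∂(ProbabilityTheory.cond volume C)) ∂(Measure.pi fun _ : Fin n => ν)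
      ≤ 2 * √(∫ q, (interp (design q.1) (labels q.1) q.2 - g q.2) ^ 2
        ∂((Measure.pi fun _ : Fin n => ν).prod (ProbabilityTheory.cond volume C))) := by
  have := isProbabilityMeasure_cond_volume hCc hCint
  set μ := ProbabilityTheory.cond (volume : Measure (Pt d)) C with hμ
  set Q := Measure.pi fun _ : Fin n => ν with hQ
  have hem : Measurable fun q : (Fin n → Pt d × ℝ) × Pt d =>
      interp (design q.1) (labels q.1) q.2 - g q.2 :=
    measurable_interp_data.sub (h.continuous.measurable.comp measurable_snd)
  have hgen := ae_genPos_design hd hCc hCint hν n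
  have hle1 : ∀ D : Fin n → Pt d × ℝ, GenPos (design D) → ∀ z,
      |interp (design D) (labels D) z - g z| ≤ 1 := fun D hD z => by
    have h1 := hD.interp_mem_Icc (y := labels D) (fun i => label_mem_Icc (D i)) z
    have h2 := h.mem_Icc z
    rw [abs_le]; constructor <;> linarith [h1.1, h1.2, h2.1, h2.2]
  have hgen' : ∀ᵐ q ∂(Q.prod μ), GenPos (design q.1) :=
    Measure.quasiMeasurePreserving_fst.ae hgen
  have hi1 : Integrable (fun q : (Fin n → Pt d × ℝ) × Pt d =>
      |interp (design q.1) (labels q.1) q.2 - g q.2|) (Q.prod μ) := by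
    refine Integrable.of_bound hem.abs.aestronglyMeasurable 1 ?_
    filter_upwards [hgen'] with q hq
    rw [Real.norm_eq_abs, abs_abs]
    exact hle1 q.1 hq q.2
  have hi2 : Integrable (fun q : (Fin n → Pt d × ℝ) × Pt d =>
      |interp (design q.1) (labels q.1) q.2 - g q.2| ^ 2) (Q.prod μ) := by
    refine Integrable.of_bound (hem.abs.pow_const 2).aestronglyMeasurable 1 ?_
    filter_upwards [hgen'] with q hq
    rw [Real.norm_eq_abs, abs_pow, abs_abs]
    exact pow_le_one₀ (abs_nonneg _) (hle1 q.1 hq q.2)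
  have hli : Integrable (fun q : (Fin n → Pt d × ℝ) × Pt d =>
      localRisk g (interp (design q.1) (labels q.1)) q.2) (Q.prod μ) :=
    integrable_of_abs_le (B := 1) h.measurable_localRisk fun q => by
      have := h.localRisk_mem_Icc (interp (design q.1) (labels q.1)) q.2
      rw [abs_of_nonneg this.1]; exact this.2
  calc _ ≤ ∫ D, 2 * ∫ z, |interp (design D) (labels D) z - g z| ∂μ ∂Q := by
        refine integral_mono_ae (hli.integral_prod_left.sub (integrable_const _))
          (hi1.integral_prod_left.const_mul 2) ?_
        filter_upwards [hgen] with D hD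
        have hmz := measurable_interp_data_right D
        have hez : Integrable (fun z => |interp (design D) (labels D) z - g z|) μ :=
          integrable_of_abs_le (B := 1) (hmz.sub h.continuous.measurable).abs fun z => by
            rw [abs_abs]; exact hle1 D hD z
        rw [← integral_sub (h.integrable_localRisk hmz)
          (h.integrable_localRisk h.continuous.measurable), ← integral_const_mul]
        exact integral_mono ((h.integrable_localRisk hmz).sub
          (h.integrable_localRisk h.continuous.measurable)) (hez.const_mul 2)
          fun z => localRisk_sub_le g _ z
    _ = 2 * ∫ q, |interp (design q.1) (labels q.1) q.2 - g q.2| ∂(Q.prod μ) := by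
        rw [integral_const_mul, integral_prod _ hi1]
    _ ≤ _ := by
        have := integral_le_sqrt_integral_sq hi1 hi2
        simp only [sq_abs] at this
        linarith

/-- Eventually the expected excess risk is close to the asymptotic bound. -/
lemma IsRegression.eventually_integral_excess_le [IsProbabilityMeasure ν] (h : IsRegression ν g)
    {T : (n : ℕ) → (Fin n → Pt d) → Finset (Finset (Fin n))} (hT : IsDelaunayScheme T)
    (hd : 1 ≤ d) (hCc : IsCompact C) (hCconv : Convex ℝ C) (hCint : (interior C).Nonempty)
    (hν : ν.map Prod.fst = ProbabilityTheory.cond volume C) {ε : ℝ} (hε0 : 0 < ε) (hε1 : ε ≤ 1) :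
    ∀ᶠ n in atTop,
      ∫ D, (∫ z, localRisk g (interp (design D) (labels D)) z ∂(ProbabilityTheory.cond volume C)
        - ∫ z, localRisk g g z ∂(ProbabilityTheory.cond volume C)) ∂(Measure.pi fun _ : Fin n => ν)
      ≤ 2 * √(ε + (2 / (d + 2) * (∫ z, bernoulliVar g z ∂(ProbabilityTheory.cond volume C)
          + 2 * ε) + ε)) := by
  obtain ⟨δ, hδ, hδg⟩ := Metric.uniformContinuousOn_iff_le.1
    (hCc.uniformContinuousOn_of_continuous h.continuous.continuousOn) ε hε0
  filter_upwards [(hT.tendsto_badSet hd hCc hCconv hCint hν hδ).eventually_le_const hε0] with n hn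
  refine (h.integral_excess_le hd hCc hCint hν n).trans ?_
  gcongr
  refine (h.mse_le hd hCc hCconv hCint hν hε0.le hε1
    (fun u hu v hv huv => hδg u hu v hv huv) n).trans ?_
  gcongr

end SimplicialRisk

end

/-! ### Assembly of the theorem. -/

/-- The test example `(X, Y)` is `(X 0, Y 0)`, the training data are `(X 1, Y 1), (X 2, Y 2), …`. -/
theorem mainTheorem7 {d : ℕ} (hd : 1 ≤ d)
    {Ω : Type*} [MeasurableSpace Ω] (P : Measure Ω) [IsProbabilityMeasure P]
    (X : ℕ → Ω → SimplicialRisk.Pt d) (Y : ℕ → Ω → ℝ)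
    (hX : ∀ i, Measurable (X i)) (hY : ∀ i, Measurable (Y i))
    (hindep : iIndepFun (fun i ω => (X i ω, Y i ω)) P)
    (hident : ∀ i, IdentDistrib (fun ω => (X i ω, Y i ω)) (fun ω => (X 0 ω, Y 0 ω)) P P)
    (hbinary : ∀ᵐ ω ∂P, Y 0 ω = 0 ∨ Y 0 ω = 1)
    -- `η` is the conditional mean and `v` the conditional variance of `Y` given `X`
    (η v : SimplicialRisk.Pt d → ℝ)
    (hη : (fun ω => η (X 0 ω)) =ᵐ[P] P[Y 0 | MeasurableSpace.comap (X 0) inferInstance])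
    (hv : (fun ω => v (X 0 ω)) =ᵐ[P] Var[Y 0; P | MeasurableSpace.comap (X 0) inferInstance])
    -- the law of `X` is uniform on a full-dimensional compact convex set
    (C : Set (SimplicialRisk.Pt d)) (hCcompact : IsCompact C) (hCconvex : Convex ℝ C)
    (hCfull : (interior C).Nonempty) (hunif : pdf.IsUniform (X 0) C P volume)
    (hsimple : SimplicialRisk.IsSimplePolytope (P.map (X 0)).support)
    (A α A' α' : ℝ) (hα : 0 < α) (hα' : 0 < α')
    (hηsmooth : SimplicialRisk.IsSmoothOnSupport (P.map (X 0)) η A α)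
    (hvsmooth : SimplicialRisk.IsSmoothOnSupport (P.map (X 0)) v A' α')
    (T : (n : ℕ) → (Fin n → SimplicialRisk.Pt d) → Finset (Finset (Fin n)))
    (hT : SimplicialRisk.IsDelaunayScheme T) :
    (∀ n, d < n → Integrable (fun ω =>
      SimplicialRisk.risk P (X 0) (Y 0) (SimplicialRisk.simplicialClassifier T X Y n ω)
        - SimplicialRisk.risk P (X 0) (Y 0) (SimplicialRisk.plugIn η)) P) ∧
    limsup (fun n : ℕ => ∫ ω,
      (SimplicialRisk.risk P (X 0) (Y 0) (SimplicialRisk.simplicialClassifier T X Y n ω)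
        - SimplicialRisk.risk P (X 0) (Y 0) (SimplicialRisk.plugIn η)) ∂P) atTop
      ≤ √(8 / ((d : ℝ) + 2) * ∫ ω, (Y 0 ω - η (X 0 ω)) ^ 2 ∂P) := by
  open SimplicialRisk in
  obtain ⟨g, hg, hgη⟩ := exists_isRegression (hX 0) (hY 0) hbinary hη (hηsmooth.continuousOn hα)
  have hXY : ∀ i, Measurable fun ω => (X i ω, Y i ω) := fun i => (hX i).prodMk (hY i)
  set ν := P.map fun ω => (X 0 ω, Y 0 ω) with hνdef
  have hνprob : IsProbabilityMeasure ν := Measure.isProbabilityMeasure_map (hXY 0).aemeasurable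
  set μ := ProbabilityTheory.cond (volume : Measure (Pt d)) C with hμ
  have hμprob : IsProbabilityMeasure μ := isProbabilityMeasure_cond_volume hCcompact hCfull
  have hPX : P.map (X 0) = μ := hunif
  have hν : ν.map Prod.fst = μ := by
    rw [hνdef, Measure.map_map measurable_fst (hXY 0), ← hPX]; rfl
  set data : (n : ℕ) → Ω → Fin n → Pt d × ℝ := fun n ω i => (X (i + 1) ω, Y (i + 1) ω)
  have hdm : ∀ n, Measurable (data n) := fun n => measurable_pi_iff.2 fun i => hXY (i + 1)
  have hlaw : ∀ n, P.map (data n) = Measure.pi fun _ : Fin n => ν := fun n => by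
    have hinj : Function.Injective fun i : Fin n => (i : ℕ) + 1 := fun i j hij => by
      ext; simpa using hij
    have := (hindep.precomp hinj).map_fun_eq_pi_map fun i => (hXY _).aemeasurable
    refine this.trans (congrArg Measure.pi (funext fun i => (hident _).map_eq))
  have hbayes : risk P (X 0) (Y 0) (plugIn η) = ∫ z, localRisk g g z ∂μ := by
    rw [← hPX, ← hg.risk_plugIn_eq (hX 0) (hY 0) hg.continuous.measurable]
    refine measureReal_congr ?_
    filter_upwards [hgη] with ω hω
    change (plugIn η (X 0 ω) ≠ Y 0 ω) = (plugIn g (X 0 ω) ≠ Y 0 ω)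
    simp only [plugIn, hω]
  have hbin : ∀ n, ∀ᵐ ω ∂P, ∀ i, (data n ω i).2 = 0 ∨ (data n ω i).2 = 1 := fun n => by
    refine ae_of_ae_map (p := fun D => ∀ i, (D i).2 = 0 ∨ (D i).2 = 1) (hdm n).aemeasurable ?_
    rw [hlaw]
    exact ae_pi_of_ae hg.binary
  have hgen : ∀ n, ∀ᵐ ω ∂P, GenPos (design (data n ω)) := fun n => by
    refine ae_of_ae_map (p := fun D => GenPos (design D)) (hdm n).aemeasurable ?_
    rw [hlaw]
    exact ae_genPos_design hd hCcompact hCfull hν n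
  -- The risk only sees the classifier up to null sets of `z`, so almost surely it equals a
  -- measurable function of the data. This is what makes the excess risk integrable for an arbitrary
  -- scheme.
  have hrisk : ∀ n, d < n → ∀ᵐ ω ∂P, risk P (X 0) (Y 0) (simplicialClassifier T X Y n ω)
      = ∫ z, localRisk g (interp (design (data n ω)) (labels (data n ω))) z ∂μ := by
    intro n hn
    filter_upwards [hbin n, hgen n] with ω h1 h2
    have hlab : labels (data n ω) = fun i : Fin n => Y (i + 1) ω :=
      funext fun i => label_eq (h1 i)
    have hdes : design (data n ω) = fun i : Fin n => X (i + 1) ω := rfl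
    have hdel := hT n _ (h2.affineSpan_eq_top hn)
    rw [← hPX, ← hg.risk_plugIn_eq (hX 0) (hY 0)
      (measurable_interp_data_right (data n ω))]
    refine risk_congr (hX 0) (Y 0) ?_
    rw [hPX]
    filter_upwards [cond_volume_absolutelyContinuous.ae_le h2.ae_offFacets] with z hz
    have := hdel.simplicialInterp_eq h2 (labels (data n ω)) hz
    rw [hlab, hdes] at this
    rw [hlab, hdes, simplicialClassifier, plugIn, plugIn, this]
  have hRm : ∀ n, StronglyMeasurable fun D : Fin n → Pt d × ℝ =>
      ∫ z, localRisk g (interp (design D) (labels D)) z ∂μ := fun n =>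
    hg.measurable_localRisk.stronglyMeasurable.integral_prod_right
  have hR1 : ∀ h : Pt d → ℝ, ∫ z, localRisk g h z ∂μ ∈ Set.Icc (0 : ℝ) 1 := fun h => by
    refine ⟨integral_nonneg fun z => (hg.localRisk_mem_Icc h z).1, ?_⟩
    have := norm_integral_le_of_norm_le_const (μ := μ) (f := localRisk g h) (C := 1)
      (Eventually.of_forall fun z => by
        rw [Real.norm_eq_abs, abs_of_nonneg (hg.localRisk_mem_Icc h z).1]
        exact (hg.localRisk_mem_Icc h z).2)
    rw [probReal_univ, mul_one] at this
    exact (le_abs_self _).trans this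
  have hexcess : ∀ n, d < n → ∫ ω, (risk P (X 0) (Y 0) (simplicialClassifier T X Y n ω)
        - risk P (X 0) (Y 0) (plugIn η)) ∂P
      = ∫ D, (∫ z, localRisk g (interp (design D) (labels D)) z ∂μ
          - ∫ z, localRisk g g z ∂μ) ∂(Measure.pi fun _ : Fin n => ν) := by
    intro n hn
    have hm : StronglyMeasurable fun D : Fin n → Pt d × ℝ =>
        ∫ z, localRisk g (interp (design D) (labels D)) z ∂μ - ∫ z, localRisk g g z ∂μ :=
      (hRm n).sub stronglyMeasurable_const
    rw [← hlaw, integral_map (hdm n).aemeasurable hm.aestronglyMeasurable]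
    refine integral_congr_ae ?_
    filter_upwards [hrisk n hn] with ω hω
    rw [hω, hbayes]
  refine ⟨fun n hn => ?_, ?_⟩
  · have hint : Integrable (fun ω => ∫ z, localRisk g (interp (design (data n ω))
        (labels (data n ω))) z ∂μ - risk P (X 0) (Y 0) (plugIn η)) P := by
      refine Integrable.sub ?_ (integrable_const _)
      refine integrable_of_abs_le (B := 1) ((hRm n).measurable.comp (hdm n)) fun ω => ?_
      rw [abs_of_nonneg (hR1 _).1]; exact (hR1 _).2
    refine hint.congr ?_
    filter_upwards [hrisk n hn] with ω hω
    rw [hω]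
  · have hvar : ∫ ω, (Y 0 ω - η (X 0 ω)) ^ 2 ∂P = ∫ z, bernoulliVar g z ∂μ := by
      rw [← hν, ← hg.integral_noise_sq, hνdef, integral_map (hXY 0).aemeasurable
        (hg.measurable_noise.pow_const 2).aestronglyMeasurable]
      refine integral_congr_ae ?_
      filter_upwards [hbinary, hgη] with ω h1 h2
      rw [label_eq (q := (X 0 ω, Y 0 ω)) h1, h2]
    rw [hvar]
    set V := ∫ z, bernoulliVar g z ∂μ with hV
    -- A real `limsup` is bounded by an eventual upper bound only if the sequence is also bounded
    -- below.
    have hlow : ∀ n, -1 ≤ ∫ ω, (risk P (X 0) (Y 0) (simplicialClassifier T X Y n ω)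
        - risk P (X 0) (Y 0) (plugIn η)) ∂P := fun n => by
      have := norm_integral_le_of_norm_le_const (μ := P) (C := 1)
        (f := fun ω => risk P (X 0) (Y 0) (simplicialClassifier T X Y n ω)
          - risk P (X 0) (Y 0) (plugIn η)) (Eventually.of_forall fun ω => by
          have h0 : ∀ f, 0 ≤ risk P (X 0) (Y 0) f := fun f => measureReal_nonneg
          have h1 : ∀ f, risk P (X 0) (Y 0) f ≤ 1 := fun f => measureReal_le_one
          rw [Real.norm_eq_abs, abs_le]
          constructor <;> linarith [h0 (plugIn η), h1 (plugIn η),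
            h0 (simplicialClassifier T X Y n ω), h1 (simplicialClassifier T X Y n ω)])
      rw [probReal_univ, mul_one] at this
      exact (abs_le.1 this).1
    have hbound : ∀ ε ∈ Set.Ioc (0 : ℝ) 1, limsup (fun n : ℕ => ∫ ω,
        (risk P (X 0) (Y 0) (simplicialClassifier T X Y n ω)
          - risk P (X 0) (Y 0) (plugIn η)) ∂P) atTop
        ≤ 2 * √(ε + (2 / (d + 2) * (V + 2 * ε) + ε)) := fun ε hε => by
      refine limsup_le_of_le (isCoboundedUnder_le_of_le atTop hlow) ?_
      filter_upwards [eventually_gt_atTop d, hg.eventually_integral_excess_le hT hd hCcompact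
        hCconvex hCfull hν hε.1 hε.2] with n hn hle
      rw [hexcess n hn]
      exact hle
    have hlim : Tendsto (fun ε : ℝ => 2 * √(ε + (2 / ((d : ℝ) + 2) * (V + 2 * ε) + ε)))
        (nhdsWithin 0 (Set.Ioi 0)) (nhds (√(8 / ((d : ℝ) + 2) * V))) := by
      have hc : Continuous fun ε : ℝ => 2 * √(ε + (2 / ((d : ℝ) + 2) * (V + 2 * ε) + ε)) := by
        fun_prop
      have h0 : 2 * √((0 : ℝ) + (2 / ((d : ℝ) + 2) * (V + 2 * 0) + 0))
          = √(8 / ((d : ℝ) + 2) * V) := by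
        rw [show 8 / ((d : ℝ) + 2) * V = 2 ^ 2 * (2 / ((d : ℝ) + 2) * V) by ring,
          Real.sqrt_mul (by positivity), Real.sqrt_sq (by positivity)]
        simp
      rw [← h0]
      exact (hc.tendsto 0).mono_left nhdsWithin_le_nhds
    -- The bound holds for every `ε` in `(0, 1]`, and the limsup does not depend on `ε`; now let `ε`
    -- tend to zero.
    refine ge_of_tendsto hlim ?_
    filter_upwards [Ioc_mem_nhdsGT (zero_lt_one' ℝ)] with ε hε using hbound ε hε
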